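/- Let $H_4$ be the complex Lie algebra with basis $a,b,c,d$ and brackets $[a,b]=c$, $[d,a]=a$, $[d,b]=-b$, $c$ central, with the symmetric invariant bilinear form determined by $(a,b)=(c,d)=1$ and all other pairings of basis vectors equal to $0$. Let $\widehat H_4=H_4\otimes\mathbb C[t,t^{-1}]\oplus\mathbb C\mathbf k$ be the affine Lie algebra with $\mathbf k$ central and, writing $x(n)=x\otimes t^n$, $[x(m),y(n)]=[x,y](m+n)+m(x,y)\delta_{m+n,0}\mathbf k$. Let $\tau$ be the involution $a\leftrightarrow b$, $c\mapsto -c$, $d\mapsto -d$ of $H_4$, and let $\mathfrak g=\widehat H_4[\tau]$ be the subalgebra of fixed points of the automorphism $x(n)+s\mathbf k\mapsto(-1)^n\tau(x)(n)+s\mathbf k$ of $\widehat H_4$. Let $\mathfrak g^{(+)}$ be the subalgebra spanned by $(a+b)(n)$ for positive even $n$ and $(a-b)(m),c(m),d(m)$ for positive odd $m$. Put $U=U(\mathfrak g)$. For a Lie algebra homomorphism $\psi:\mathfrak g^{(+)}\to\mathbb C$, a Whittaker vector of type $\psi$ in a $\mathfrak g$-module is a vector $v\neq0$ with $xv=\psi(x)v$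 for all $x\in\mathfrak g^{(+)}$; it is cyclic if it generates the module, and a module with a cyclic Whittaker vector of type $\psi$ is called a Whittaker module of type $\psi$. Let $\mathbb C_\psi$ be the one-dimensional $\mathfrak g^{(+)}$-module given by $\psi$, let $M_\psi=U\otimes_{U(\mathfrak g^{(+)})}\mathbb C_\psi$ and, for $\xi\in\mathbb C$, $L_{\psi,\xi}=M_\psi/(\mathbf k-\xi)M_\psi$, and let $\bar\omega\in L_{\psi,\xi}$ be the image of $1\otimes1$. **Theorem.** Let $\psi=0$, $\xi\in\mathbb C\setminus\{0\}$ and $l\in\mathbb C$. Let $M(\xi,l)=L_{0,\xi}/U((a+b)(0)-l)\bar\omega$ be the Verma module. For integers $i\ge0$ put $\omega_i=((a+b)(0)-l)^i\bar\omega$ and $M^i=U\omega_i\subseteq L_{0,\xi}$. Then: (i) for every $i\ge 0$, $M^i$ is a Whittaker module of type $0$ with cyclic Whittaker vector $\omega_i$, and $M^{i+1}$ is a maximal (proper) submodule of $M^i$; (ii) $L_{0,\xi}\cong M^i$ for every $i\ge0$; (iii) $M^i/M^{i+1}\cong M(\xi,l)$ for every $i\ge0$, and the multiplicity space of $M(\xi,l)$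 consists of polynomials in one variable: there is an isomorphism of $\mathfrak g$-modules $$M(\xi,l)\otimes_{\mathbb C}\mathbb C[X]\;\cong\;\bigoplus_{i\ge0}M^i/M^{i+1},$$ with $\mathfrak g$ acting on the left factor only, which for every $i\ge0$ sends the image of $\bar\omega$ in $M(\xi,l)$ tensored with $X^i$ to the class of $\omega_i$ in $M^i/M^{i+1}$; (iv) $L_{0,\xi}=M^0\supseteq M^1\supseteq\cdots\supseteq M^i\supseteq\cdots$ is a filtration all of whose sections $M^i/M^{i+1}$ are simple; $M(\xi,l)$ is simple, and it is isomorphic to $M^i/M^{i+1}$ for infinitely many $i$. -/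

import Mathlib

open scoped TensorProduct

noncomputable section

attribute [local instance 100] LieRing.ofAssociativeRing

namespace NappiWitten

/-! ### The Nappi–Witten Lie algebra -/

/-- The four-dimensional Nappi–Witten Lie algebra; the coordinates `0, 1, 2, 3` are those along
the basis vectors `a, b, c, d`. -/
def H4 : Type := Fin 4 → ℂ

namespace H4

instance : AddCommGroup H4 := inferInstanceAs (AddCommGroup (Fin 4 → ℂ))
instance : Module ℂ H4 := inferInstanceAs (Module ℂ (Fin 4 → ℂ))

/-- The vector `p a + q b + r c + s d`. -/
def mk (p q r s : ℂ) : H4 := (![p, q, r, s] : Fin 4 → ℂ)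

@[ext] theorem ext {x y : H4} (h0 : x 0 = y 0) (h1 : x 1 = y 1) (h2 : x 2 = y 2)
    (h3 : x 3 = y 3) : x = y := by
  funext i; fin_cases i <;> assumption

@[simp] theorem mk_zero (p q r s : ℂ) : mk p q r s 0 = p := rfl
@[simp] theorem mk_one (p q r s : ℂ) : mk p q r s 1 = q := rfl
@[simp] theorem mk_two (p q r s : ℂ) : mk p q r s 2 = r := rfl
@[simp] theorem mk_three (p q r s : ℂ) : mk p q r s 3 = s := rfl
@[simp] theorem add_apply (x y : H4) (i : Fin 4) : (x + y) i = x i + y i := rfl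
@[simp] theorem sub_apply (x y : H4) (i : Fin 4) : (x - y) i = x i - y i := rfl
@[simp] theorem neg_apply (x : H4) (i : Fin 4) : (-x) i = -x i := rfl
@[simp] theorem zero_apply (i : Fin 4) : (0 : H4) i = 0 := rfl
@[simp] theorem smul_apply (t : ℂ) (x : H4) (i : Fin 4) : (t • x) i = t * x i := rfl

def a : H4 := mk 1 0 0 0
def b : H4 := mk 0 1 0 0
def c : H4 := mk 0 0 1 0
def d : H4 := mk 0 0 0 1

/-- The bilinear extension of `[a, b] = c`, `[d, a] = a`, `[d, b] = -b`, `c` central. -/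
instance : Bracket H4 H4 where
  bracket x y := mk (x 3 * y 0 - x 0 * y 3) (-(x 3 * y 1 - x 1 * y 3)) (x 0 * y 1 - x 1 * y 0) 0

theorem bracket_def (x y : H4) : ⁅x, y⁆ =
    mk (x 3 * y 0 - x 0 * y 3) (-(x 3 * y 1 - x 1 * y 3)) (x 0 * y 1 - x 1 * y 0) 0 := rfl

instance : LieRing H4 where
  add_lie x y z := by ext <;> simp [bracket_def] <;> ring
  lie_add x y z := by ext <;> simp [bracket_def] <;> ring
  lie_self x := by ext <;> simp [bracket_def] <;> ring
  leibniz_lie x y z := by ext <;> simp [bracket_def] <;> ring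

instance : LieAlgebra ℂ H4 where
  lie_smul t x y := by ext <;> simp [bracket_def] <;> ring

theorem lie_a_b : ⁅a, b⁆ = c := by ext <;> simp [bracket_def, a, b, c]
theorem lie_d_a : ⁅d, a⁆ = a := by ext <;> simp [bracket_def, a, d]
theorem lie_d_b : ⁅d, b⁆ = -b := by ext <;> simp [bracket_def, b, d]
theorem c_lie (x : H4) : ⁅c, x⁆ = 0 := by ext <;> simp [bracket_def, c]

/-- The symmetric bilinear form with `(a, b) = (c, d) = 1` and all other pairings of basis vectors
zero. -/
def form : LinearMap.BilinForm ℂ H4 :=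
  LinearMap.mk₂ ℂ (fun x y => x 0 * y 1 + x 1 * y 0 + x 2 * y 3 + x 3 * y 2)
    (by intros; simp; ring) (by intros; simp; ring) (by intros; simp; ring)
    (by intros; simp; ring)

theorem form_apply (x y : H4) :
    form x y = x 0 * y 1 + x 1 * y 0 + x 2 * y 3 + x 3 * y 2 := rfl

theorem form_isSymm : form.IsSymm := ⟨fun x y => by simp [form_apply]; ring⟩

theorem form_lieInvariant : form.lieInvariant H4 := fun x y z => by
  simp [form_apply, bracket_def]; ring

/-- The involution `a ↔ b`, `c ↦ -c`, `d ↦ -d`. -/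
def tau : H4 →ₗ⁅ℂ⁆ H4 where
  toFun x := mk (x 1) (x 0) (-x 2) (-x 3)
  map_add' x y := by ext <;> simp <;> ring
  map_smul' t x := by ext <;> simp
  map_lie' := by intro x y; ext <;> simp [bracket_def] <;> ring

theorem tau_apply (x : H4) : tau x = mk (x 1) (x 0) (-x 2) (-x 3) := rfl

theorem form_tau (x y : H4) : form (tau x) (tau y) = form x y := by
  simp [form_apply, tau_apply]; ring

end H4

/-! ### The affine Nappi–Witten Lie algebra -/

/-- The vector space `H4 ⊗ ℂ[t, t⁻¹]`: the function `f` stands for `∑ₙ f(n) ⊗ tⁿ`. -/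
abbrev Loop : Type := ℤ →₀ H4

/-- The untwisted affine Nappi–Witten Lie algebra `H4 ⊗ ℂ[t, t⁻¹] ⊕ ℂ k`; the pair `(f, s)` stands
for `∑ₙ f(n) ⊗ tⁿ + s k`. -/
def Aff : Type := Loop × ℂ

namespace Aff

instance : AddCommGroup Aff := inferInstanceAs (AddCommGroup (Loop × ℂ))
instance : Module ℂ Aff := inferInstanceAs (Module ℂ (Loop × ℂ))

/-- The component in `H4 ⊗ ℂ[t, t⁻¹]`. -/
def loop : Aff →ₗ[ℂ] Loop := LinearMap.fst ℂ Loop ℂ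

/-- The coefficient of `k`. -/
def central : Aff →ₗ[ℂ] ℂ := LinearMap.snd ℂ Loop ℂ

/-- The element `f + s k`. -/
def mk (f : Loop) (s : ℂ) : Aff := (f, s)

@[simp] theorem loop_mk (f : Loop) (s : ℂ) : (mk f s).loop = f := rfl
@[simp] theorem central_mk (f : Loop) (s : ℂ) : (mk f s).central = s := rfl

@[ext] theorem ext {u v : Aff} (h : u.loop = v.loop) (h' : u.central = v.central) : u = v :=
  Prod.ext h h'

/-- The bracket of the loop algebra: `[x ⊗ tᵐ, y ⊗ tⁿ] = [x, y] ⊗ tᵐ⁺ⁿ`. -/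
def loopLie : Loop →ₗ[ℂ] Loop →ₗ[ℂ] Loop :=
  LinearMap.mk₂ ℂ (fun f g => f.sum fun m x => g.sum fun n y => Finsupp.single (m + n) ⁅x, y⁆)
    (fun f f' g => by
      rw [Finsupp.sum_add_index'] <;> simp [Finsupp.sum_add])
    (fun t f g => by
      rw [Finsupp.sum_smul_index' (by simp), Finsupp.smul_sum]
      simp [Finsupp.smul_sum])
    (fun f g g' => by
      rw [← Finsupp.sum_add]
      congr; ext1 m; ext1 x
      rw [Finsupp.sum_add_index'] <;> simp)
    (fun t f g => by
      rw [Finsupp.smul_sum]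
      congr; ext1 m; ext1 x
      rw [Finsupp.sum_smul_index' (by simp), Finsupp.smul_sum]
      simp)

theorem loopLie_single (x y : H4) (m n : ℤ) :
    loopLie (Finsupp.single m x) (Finsupp.single n y) = Finsupp.single (m + n) ⁅x, y⁆ := by
  simp [loopLie]

/-- The cocycle: `(x ⊗ tᵐ, y ⊗ tⁿ) ↦ m (x, y) δ_{m+n,0}`. -/
def cocycle : Loop →ₗ[ℂ] Loop →ₗ[ℂ] ℂ :=
  LinearMap.mk₂ ℂ (fun f g => f.sum fun m x => (m : ℂ) * H4.form x (g (-m)))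
    (fun f f' g => by
      rw [Finsupp.sum_add_index'] <;> simp [mul_add])
    (fun t f g => by
      rw [Finsupp.sum_smul_index' (by simp), Finsupp.smul_sum]
      simp [mul_left_comm])
    (fun f g g' => by
      rw [← Finsupp.sum_add]
      simp [mul_add])
    (fun t f g => by
      rw [Finsupp.smul_sum]
      simp [mul_left_comm])

theorem cocycle_single (x y : H4) (m n : ℤ) :
    cocycle (Finsupp.single m x) (Finsupp.single n y) =
      if m + n = 0 then (m : ℂ) * H4.form x y else 0 := by
  simp only [cocycle, LinearMap.mk₂_apply]
  rw [Finsupp.sum_single_index (by simp)]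
  split_ifs with h
  · obtain rfl : n = -m := by omega
    simp
  · rw [Finsupp.single_eq_of_ne (by omega)]; simp

instance : Bracket Aff Aff where
  bracket u v := mk (loopLie u.loop v.loop) (cocycle u.loop v.loop)

@[simp] theorem loop_lie (u v : Aff) : ⁅u, v⁆.loop = loopLie u.loop v.loop := rfl
@[simp] theorem central_lie (u v : Aff) : ⁅u, v⁆.central = cocycle u.loop v.loop := rfl

theorem loopLie_skew (f g : Loop) : loopLie f g = -loopLie g f := by
  induction f using Finsupp.induction_linear with
  | zero => simp
  | add f f' h h' => simp only [map_add, LinearMap.add_apply, h, h', neg_add]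
  | single m x =>
    induction g using Finsupp.induction_linear with
    | zero => simp
    | add f f' h h' => simp only [map_add, LinearMap.add_apply, h, h', neg_add]
    | single n y => rw [loopLie_single, loopLie_single, add_comm, ← lie_skew, Finsupp.single_neg]

theorem cocycle_skew (f g : Loop) : cocycle f g = -cocycle g f := by
  induction f using Finsupp.induction_linear with
  | zero => simp
  | add f f' h h' => simp only [map_add, LinearMap.add_apply, h, h', neg_add]
  | single m x =>
    induction g using Finsupp.induction_linear with
    | zero => simp
    | add f f' h h' => simp only [map_add, LinearMap.add_apply, h, h', neg_add]
    | single n y =>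
      rw [cocycle_single, cocycle_single, add_comm n m, H4.form_isSymm.eq y x]
      split_ifs with h
      · obtain rfl : n = -m := by omega
        simp
      · simp

theorem loopLie_jacobi (f g h : Loop) :
    loopLie f (loopLie g h) = loopLie (loopLie f g) h + loopLie g (loopLie f h) := by
  induction f using Finsupp.induction_linear with
  | zero => simp
  | add f f' h h' => simp only [map_add, LinearMap.add_apply, h, h']; abel
  | single m x =>
    induction g using Finsupp.induction_linear with
    | zero => simp
    | add f f' h h' => simp only [map_add, LinearMap.add_apply, h, h']; abel
    | single n y =>
      induction h using Finsupp.induction_linear with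
      | zero => simp
      | add f f' h h' => simp only [map_add, h, h']; abel
      | single p z =>
        simp only [loopLie_single]
        rw [leibniz_lie, Finsupp.single_add, add_assoc, add_left_comm n m p]

theorem cocycle_jacobi (f g h : Loop) :
    cocycle f (loopLie g h) = cocycle (loopLie f g) h + cocycle g (loopLie f h) := by
  induction f using Finsupp.induction_linear with
  | zero => simp
  | add f f' h h' => simp only [map_add, LinearMap.add_apply, h, h']; abel
  | single m x =>
    induction g using Finsupp.induction_linear with
    | zero => simp
    | add f f' h h' => simp only [map_add, LinearMap.add_apply, h, h']; abel
    | single n y =>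
      induction h using Finsupp.induction_linear with
      | zero => simp
      | add f f' h h' => simp only [map_add, h, h']; abel
      | single p z =>
        simp only [loopLie_single, cocycle_single, add_assoc, add_left_comm n m p]
        split_ifs with h
        · have h1 : (p : ℂ) = -m - n := by
            have : (m : ℂ) + (n + p) = 0 := by exact_mod_cast h
            linear_combination this
          simp only [H4.form_apply, H4.bracket_def, H4.mk_zero, H4.mk_one, H4.mk_two, H4.mk_three]
          push_cast
          ring
        · simp

instance : LieRing Aff where
  add_lie u v w := by ext1 <;> simp
  lie_add u v w := by ext1 <;> simp
  lie_self u := by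
    ext1
    · have h : (2 : ℂ) • loopLie u.loop u.loop = 0 := by
        rw [two_smul]
        nth_rw 1 [loopLie_skew]
        exact neg_add_cancel _
      simpa using h
    · exact self_eq_neg.mp (cocycle_skew u.loop u.loop)
  leibniz_lie u v w := by
    ext1
    · simpa using loopLie_jacobi u.loop v.loop w.loop
    · simpa using cocycle_jacobi u.loop v.loop w.loop

instance : LieAlgebra ℂ Aff where
  lie_smul t u v := by ext1 <;> simp

/-- The element `x(n) = x ⊗ tⁿ`. -/
def el (x : H4) (n : ℤ) : Aff := mk (Finsupp.single n x) 0

/-- The central element `k`. -/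
def k : Aff := mk 0 1

/-- The defining bracket of the affine algebra. -/
theorem el_lie_el (x y : H4) (m n : ℤ) : ⁅el x m, el y n⁆ =
    el ⁅x, y⁆ (m + n) + (if m + n = 0 then (m : ℂ) * H4.form x y else 0) • k := by
  split_ifs with h <;> ext1 <;> simp [el, k, loopLie_single, cocycle_single, h]

theorem k_lie (u : Aff) : ⁅k, u⁆ = 0 := by
  ext1 <;> simp [k]

/-- The linear map `x ⊗ tⁿ ↦ (-1)ⁿ τ(x) ⊗ tⁿ`. -/
def tauLoop : Loop →ₗ[ℂ] Loop :=
  Finsupp.lsum ℂ fun n => (-1 : ℂ) ^ n • (Finsupp.lsingle n ∘ₗ (H4.tau : H4 →ₗ[ℂ] H4))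

theorem tauLoop_single (x : H4) (n : ℤ) :
    tauLoop (Finsupp.single n x) = (-1 : ℂ) ^ n • Finsupp.single n (H4.tau x) := by
  simp [tauLoop]

theorem tauLoop_loopLie (f g : Loop) :
    tauLoop (loopLie f g) = loopLie (tauLoop f) (tauLoop g) := by
  induction f using Finsupp.induction_linear with
  | zero => simp
  | add f f' h h' => simp only [map_add, LinearMap.add_apply, h, h']
  | single m x =>
    induction g using Finsupp.induction_linear with
    | zero => simp
    | add f f' h h' => simp only [map_add, h, h']
    | single n y =>
      simp only [loopLie_single, tauLoop_single, map_smul, LinearMap.smul_apply, LieHom.map_lie,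
        smul_smul]
      rw [zpow_add₀ (by norm_num), mul_comm]

theorem cocycle_tauLoop (f g : Loop) : cocycle (tauLoop f) (tauLoop g) = cocycle f g := by
  induction f using Finsupp.induction_linear with
  | zero => simp
  | add f f' h h' => simp only [map_add, LinearMap.add_apply, h, h']
  | single m x =>
    induction g using Finsupp.induction_linear with
    | zero => simp
    | add f f' h h' => simp only [map_add, h, h']
    | single n y =>
      simp only [tauLoop_single, map_smul, LinearMap.smul_apply, cocycle_single, H4.form_tau,
        smul_eq_mul]
      split_ifs with h
      · rw [← mul_assoc, ← zpow_add₀ (by norm_num), add_comm n m, h]; simp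
      · simp

/-- The automorphism `x ⊗ tⁿ + s k ↦ (-1)ⁿ τ(x) ⊗ tⁿ + s k`. -/
def tauHat : Aff →ₗ⁅ℂ⁆ Aff where
  toFun u := mk (tauLoop u.loop) u.central
  map_add' u v := by ext1 <;> simp
  map_smul' t u := by ext1 <;> simp
  map_lie' := by intro u v; ext1 <;> simp [tauLoop_loopLie, cocycle_tauLoop]

theorem tauHat_apply (u : Aff) : tauHat u = mk (tauLoop u.loop) u.central := rfl

theorem tauHat_el (x : H4) (n : ℤ) : tauHat (el x n) = (-1 : ℂ) ^ n • el (H4.tau x) n := by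
  ext1 <;> simp [tauHat_apply, el, tauLoop_single]

end Aff

open Aff (tauHat el)

/-! ### The twisted affine Nappi–Witten Lie algebra -/

/-- The twisted affine Nappi–Witten Lie algebra: the fixed points of `tauHat`. -/
def Tw : LieSubalgebra ℂ Aff where
  carrier := {u | tauHat u = u}
  add_mem' {u v} hu hv := by simp_all
  zero_mem' := by simp
  smul_mem' t u hu := by simp_all
  lie_mem' {u v} hu hv := by simp_all

theorem el_mem_Tw {x : H4} {n : ℤ} (h : (-1 : ℂ) ^ n • H4.tau x = x) : el x n ∈ Tw := by
  change tauHat _ = _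
  rw [Aff.tauHat_el]
  conv_rhs => rw [← h]
  ext1 <;> simp [el]

theorem tau_apb : H4.tau (H4.a + H4.b) = H4.a + H4.b := by
  ext <;> simp [H4.tau_apply, H4.a, H4.b]

theorem tau_amb : H4.tau (H4.a - H4.b) = -(H4.a - H4.b) := by
  ext <;> simp [H4.tau_apply, H4.a, H4.b]

theorem tau_c : H4.tau H4.c = -H4.c := by
  ext <;> simp [H4.tau_apply, H4.c]

theorem tau_d : H4.tau H4.d = -H4.d := by
  ext <;> simp [H4.tau_apply, H4.d]

theorem el_even_mem {x : H4} (hx : H4.tau x = x) (j : ℤ) : el x (2 * j) ∈ Tw :=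
  el_mem_Tw (by rw [hx, (even_two_mul j).neg_one_zpow, one_smul])

theorem el_odd_mem {x : H4} (hx : H4.tau x = -x) (j : ℤ) : el x (2 * j + 1) ∈ Tw :=
  el_mem_Tw (by rw [hx, (odd_two_mul_add_one j).neg_one_zpow, neg_one_smul, neg_neg])

/-- `(a+b)(2j)` -/
def apb (j : ℤ) : Tw := ⟨el (H4.a + H4.b) (2 * j), el_even_mem tau_apb j⟩
/-- `(a-b)(2j+1)` -/
def amb (j : ℤ) : Tw := ⟨el (H4.a - H4.b) (2 * j + 1), el_odd_mem tau_amb j⟩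
/-- `c(2j+1)` -/
def c (j : ℤ) : Tw := ⟨el H4.c (2 * j + 1), el_odd_mem tau_c j⟩
/-- `d(2j+1)` -/
def d (j : ℤ) : Tw := ⟨el H4.d (2 * j + 1), el_odd_mem tau_d j⟩
/-- The central element `k` -/
def k : Tw := ⟨Aff.k, by change tauHat Aff.k = Aff.k; ext1 <;> simp [Aff.tauHat_apply, Aff.k]⟩

theorem lie_pos {x y z : H4} {m n p : ℤ} (t : ℂ) (hx : el x m ∈ Tw) (hy : el y n ∈ Tw)
    (hz : el z p ∈ Tw) (hb : ⁅x, y⁆ = t • z) (hp : m + n = p) (h0 : p ≠ 0) :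
    ⁅(⟨el x m, hx⟩ : Tw), (⟨el y n, hy⟩ : Tw)⁆ = t • (⟨el z p, hz⟩ : Tw) := by
  apply Subtype.ext
  change ⁅el x m, el y n⁆ = t • el z p
  rw [Aff.el_lie_el, hp, if_neg h0, hb]
  ext1 <;> simp [el]

/-- The elements `(a+b)(n)` with `n` positive and even, and `(a-b)(m)`, `c(m)`, `d(m)` with `m`
positive and odd. -/
def plusGen : Set Tw :=
  {x | (∃ j : ℤ, 0 < j ∧ x = apb j) ∨ ∃ j : ℤ, 0 ≤ j ∧ (x = amb j ∨ x = c j ∨ x = d j)}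

theorem plusGen_lie {x y : Tw} (hx : x ∈ plusGen) (hy : y ∈ plusGen) :
    ⁅x, y⁆ ∈ Submodule.span ℂ plusGen := by
  have hP : ∀ (t : ℂ) (j : ℤ), 0 < j → t • apb j ∈ Submodule.span ℂ plusGen := fun t j hj =>
    Submodule.smul_mem _ _ (Submodule.subset_span (Or.inl ⟨j, hj, rfl⟩))
  have hM : ∀ (t : ℂ) (j : ℤ), 0 ≤ j → t • amb j ∈ Submodule.span ℂ plusGen := fun t j hj =>
    Submodule.smul_mem _ _ (Submodule.subset_span (Or.inr ⟨j, hj, Or.inl rfl⟩))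
  have hC : ∀ (t : ℂ) (j : ℤ), 0 ≤ j → t • c j ∈ Submodule.span ℂ plusGen := fun t j hj =>
    Submodule.smul_mem _ _ (Submodule.subset_span (Or.inr ⟨j, hj, Or.inr (Or.inl rfl)⟩))
  rcases hx with ⟨i, hi, rfl⟩ | ⟨i, hi, rfl | rfl | rfl⟩ <;>
    rcases hy with ⟨j, hj, rfl⟩ | ⟨j, hj, rfl | rfl | rfl⟩
  · convert hP 0 (i + j) (by omega) using 1
    refine lie_pos 0 _ _ _ ?_ (by ring) (by omega)
    ext <;> simp [H4.a, H4.b]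
  · convert hC (-2) (i + j) (by omega) using 1
    refine lie_pos (-2) _ _ _ ?_ (by ring) (by omega)
    ext <;> simp [H4.bracket_def, H4.a, H4.b, H4.c]; norm_num
  · convert hC 0 (i + j) (by omega) using 1
    refine lie_pos 0 _ _ _ ?_ (by ring) (by omega)
    ext <;> simp [H4.bracket_def, H4.a, H4.b, H4.c]
  · convert hM (-1) (i + j) (by omega) using 1
    refine lie_pos (-1) _ _ _ ?_ (by ring) (by omega)
    ext <;> simp [H4.bracket_def, H4.a, H4.b, H4.d]
  · convert hC 2 (i + j) (by omega) using 1
    refine lie_pos 2 _ _ _ ?_ (by ring) (by omega)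
    ext <;> simp [H4.bracket_def, H4.a, H4.b, H4.c]; norm_num
  · convert hP 0 (i + j + 1) (by omega) using 1
    refine lie_pos 0 _ _ _ ?_ (by ring) (by omega)
    ext <;> simp [H4.a, H4.b]
  · convert hP 0 (i + j + 1) (by omega) using 1
    refine lie_pos 0 _ _ _ ?_ (by ring) (by omega)
    ext <;> simp [H4.bracket_def, H4.a, H4.b, H4.c]
  · convert hP (-1) (i + j + 1) (by omega) using 1
    refine lie_pos (-1) _ _ _ ?_ (by ring) (by omega)
    ext <;> simp [H4.bracket_def, H4.a, H4.b, H4.d]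
  · convert hC 0 (i + j) (by omega) using 1
    refine lie_pos 0 _ _ _ ?_ (by ring) (by omega)
    ext <;> simp [H4.bracket_def, H4.a, H4.b, H4.c]
  · convert hP 0 (i + j + 1) (by omega) using 1
    refine lie_pos 0 _ _ _ ?_ (by ring) (by omega)
    ext <;> simp [H4.bracket_def, H4.a, H4.b, H4.c]
  · convert hP 0 (i + j + 1) (by omega) using 1
    refine lie_pos 0 _ _ _ ?_ (by ring) (by omega)
    ext <;> simp [H4.c]
  · convert hP 0 (i + j + 1) (by omega) using 1
    refine lie_pos 0 _ _ _ ?_ (by ring) (by omega)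
    ext <;> simp [H4.bracket_def, H4.c, H4.d]
  · convert hM 1 (i + j) (by omega) using 1
    refine lie_pos 1 _ _ _ ?_ (by ring) (by omega)
    ext <;> simp [H4.bracket_def, H4.a, H4.b, H4.d]
  · convert hP 1 (i + j + 1) (by omega) using 1
    refine lie_pos 1 _ _ _ ?_ (by ring) (by omega)
    ext <;> simp [H4.bracket_def, H4.a, H4.b, H4.d]
  · convert hP 0 (i + j + 1) (by omega) using 1
    refine lie_pos 0 _ _ _ ?_ (by ring) (by omega)
    ext <;> simp [H4.bracket_def, H4.c, H4.d]
  · convert hP 0 (i + j + 1) (by omega) using 1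
    refine lie_pos 0 _ _ _ ?_ (by ring) (by omega)
    ext <;> simp [H4.d]

/-- The positive part of the twisted algebra. -/
def Plus : LieSubalgebra ℂ Tw :=
  { Submodule.span ℂ plusGen with
    lie_mem' := by
      intro x y hx hy
      change x ∈ Submodule.span ℂ plusGen at hx
      change y ∈ Submodule.span ℂ plusGen at hy
      change ⁅x, y⁆ ∈ Submodule.span ℂ plusGen
      induction hx, hy using Submodule.span_induction₂ with
      | mem_mem x y hx hy => exact plusGen_lie hx hy
      | zero_left y hy => simp
      | zero_right x hx => simp
      | add_left x y z _ _ _ h h' => rw [add_lie]; exact add_mem h h'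
      | add_right x y z _ _ _ h h' => rw [lie_add]; exact add_mem h h'
      | smul_left r x y _ _ h => rw [smul_lie]; exact Submodule.smul_mem _ _ h
      | smul_right r x y _ _ h => rw [lie_smul]; exact Submodule.smul_mem _ _ h }

/-! ### Whittaker modules

A module over the twisted algebra is the same thing as a module over its universal enveloping
algebra `U`; submodules, quotients, isomorphisms and simplicity are taken over `U`. -/

/-- The universal enveloping algebra of the twisted affine Nappi–Witten Lie algebra. -/
abbrev U : Type := UniversalEnvelopingAlgebra ℂ Tw

/-- The universal enveloping algebra of the positive part. -/
abbrev UPlus : Type := UniversalEnvelopingAlgebra ℂ Plus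

/-- The canonical map of the twisted algebra to its universal enveloping algebra. -/
abbrev toU : Tw →ₗ⁅ℂ⁆ U := UniversalEnvelopingAlgebra.ι ℂ

/-- The homomorphism of enveloping algebras induced by the inclusion of the positive part. -/
def inclU : UPlus →ₐ[ℂ] U := UniversalEnvelopingAlgebra.lift ℂ (toU.comp Plus.incl)

/-- A Lie algebra homomorphism from the positive part to `ℂ`. -/
abbrev PlusChar : Type := LieAlgebra.LieCharacter ℂ Plus

/-- The action of `U(Plus)` on the one-dimensional module `ℂ_ψ`. -/
def charU (ψ : PlusChar) : UPlus →ₐ[ℂ] ℂ := UniversalEnvelopingAlgebra.lift ℂ ψ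

/-- `v` is a Whittaker vector of type `ψ`. -/
def IsWhittakerVector {V : Type*} [AddCommGroup V] [Module U V] (ψ : PlusChar) (v : V) : Prop :=
  v ≠ 0 ∧ ∀ x : Plus, toU x • v = algebraMap ℂ U (ψ x) • v

/-- `v` is a cyclic Whittaker vector of type `ψ` of the module `V`; in particular `V` is then a
Whittaker module of type `ψ`. -/
def IsCyclicWhittakerVector (V : Type*) [AddCommGroup V] [Module U V] (ψ : PlusChar) (v : V) : Prop :=
  IsWhittakerVector ψ v ∧ Submodule.span U {v} = ⊤

/-- The relations `u p ⊗ α = u ⊗ p α`, for `p ∈ U(Plus)`, of the tensor product over `U(Plus)`. -/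
def inducedRel (ψ : PlusChar) : Submodule U (U ⊗[ℂ] ℂ) :=
  Submodule.span U
    {z | ∃ (u : U) (p : UPlus) (α : ℂ), z = (u * inclU p) ⊗ₜ[ℂ] α - u ⊗ₜ[ℂ] (charU ψ p * α)}

/-- The universal Whittaker module `U ⊗_{U(Plus)} ℂ_ψ`. -/
abbrev WhittakerM (ψ : PlusChar) : Type := (U ⊗[ℂ] ℂ) ⧸ inducedRel ψ

/-- The vector `ω = 1 ⊗ 1` of the universal Whittaker module. -/
def omega (ψ : PlusChar) : WhittakerM ψ := (inducedRel ψ).mkQ (1 ⊗ₜ[ℂ] 1)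

/-- The submodule `(k - ξ) M_ψ`. -/
def kSub (ψ : PlusChar) (ξ : ℂ) : Submodule U (WhittakerM ψ) :=
  Submodule.span U (Set.range fun m => (toU k - algebraMap ℂ U ξ) • m)

/-- The quotient `L_{ψ,ξ} = M_ψ / (k - ξ) M_ψ`. -/
abbrev WhittakerL (ψ : PlusChar) (ξ : ℂ) : Type := WhittakerM ψ ⧸ kSub ψ ξ

/-- The image `ω̄` of `ω` in `L_{ψ,ξ}`. -/
def omegaBar (ψ : PlusChar) (ξ : ℂ) : WhittakerL ψ ξ := (kSub ψ ξ).mkQ (omega ψ)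

/-! ### The filtration of `L_{0,ξ}` -/

/-- The vector `ωᵢ = ((a+b)(0) - l)ⁱ ω̄` of `L_{0,ξ}`. -/
def omegaPow (ξ l : ℂ) (i : ℕ) : WhittakerL 0 ξ :=
  (toU (apb 0) - algebraMap ℂ U l) ^ i • omegaBar 0 ξ

/-- The submodule `Mⁱ = U ωᵢ` of `L_{0,ξ}`. -/
def filt (ξ l : ℂ) (i : ℕ) : Submodule U (WhittakerL 0 ξ) :=
  Submodule.span U {omegaPow ξ l i}

/-- The vector `ωᵢ` as an element of `Mⁱ`. -/
def omegaFilt (ξ l : ℂ) (i : ℕ) : filt ξ l i :=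
  ⟨omegaPow ξ l i, Submodule.mem_span_singleton_self _⟩

/-- The section `Mⁱ / Mⁱ⁺¹`. -/
abbrev FiltSection (ξ l : ℂ) (i : ℕ) : Type :=
  filt ξ l i ⧸ (filt ξ l (i + 1)).submoduleOf (filt ξ l i)

/-- The class of `ωᵢ` in `Mⁱ / Mⁱ⁺¹`. -/
def omegaSection (ξ l : ℂ) (i : ℕ) : FiltSection ξ l i :=
  ((filt ξ l (i + 1)).submoduleOf (filt ξ l i)).mkQ (omegaFilt ξ l i)

/-- The submodule `U ((a+b)(0) - l) ω̄` of `L_{0,ξ}`. -/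
def vermaSub (ξ l : ℂ) : Submodule U (WhittakerL 0 ξ) :=
  Submodule.span U {(toU (apb 0) - algebraMap ℂ U l) • omegaBar 0 ξ}

/-- The Verma module `M(ξ, l) = L_{0,ξ} / U ((a+b)(0) - l) ω̄`. -/
abbrev Verma (ξ l : ℂ) : Type := WhittakerL 0 ξ ⧸ vermaSub ξ l

/-- The highest weight vector of `M(ξ, l)`, the image of `ω̄`. -/
def vermaVec (ξ l : ℂ) : Verma ξ l := (vermaSub ξ l).mkQ (omegaBar 0 ξ)

end NappiWitten
end

open NappiWitten

/-! Write A(n) for `(a + (-1)ⁿ b)(n)` and C(n), D(n) for the odd modes of c and d. At level ξ ≠ 0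
the nonzero modes split into conjugate pairs with nonzero scalar commutator: D(n) with C(-n), C(n)
with D(-n), and A(n) with A(-n). Only A(0) has no partner. It preserves the space of vectors
annihilated by the positive part, so the whole theorem concerns polynomials in A(0).

Two facts carry the argument. The upper bound is a descent, `ModeRep.exists_aeval_mem`. A module of
level ξ generated by a singular vector ω is spanned by ordered products of negative modes D, A, C
applied to powers of A(0) on ω. Each conjugate pair acts like a variable and its derivative, so
annihilation operators strip the creation operators from any nonzero vector without killing it.
Hence every nonzero submodule contains a nonzero f(A(0)) ω.

The lower bound, `aeval_smul_omegaBar_ne_zero`, says that f(A(0)) ω̄ ≠ 0 in L for f ≠ 0. No linear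
independence of ordered monomials is invoked. Instead, for each l a representation on a polynomial
ring is constructed whose vacuum is singular with A(0)-eigenvalue l; it receives L, and f(A(0)) ω̄
goes to f(l) times the vacuum. In it c and d act by multiplications and derivatives, and the
generating series of A is α(z) E₋(z) E₊(1/z), with α a free Heisenberg field and E₋, E₊ exponentials
in the negative and positive modes of c. Since only odd modes of c occur, E(-w) E(w) = 1, and this
makes the commutator of A with itself close on C and the centre.

From these, the endomorphism ω̄ ↦ (A(0) - l) ω̄ of L is injective: its kernel would contain some
f(A(0)) ω̄ ≠ 0 with f(A(0)) (A(0) - l) ω̄ = 0. Its powers have images Mⁱ, so each Mⁱ is a copy of L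
and each section a copy of the Verma module. On the Verma generator f(A(0)) is the scalar f(l), so a
nonzero submodule contains the generator, and the Verma module is simple. -/

noncomputable section

attribute [local instance 100] LieRing.ofAssociativeRing

namespace NappiWitten

/-! ### Subspaces generated by creation operators -/

section Hull

variable {V : Type*} [AddCommGroup V] [Module ℂ V]

/-- The vectors obtained from `W` by applying `x` at most `j` times. -/
def hullStep (x : Module.End ℂ V) (W : Submodule ℂ V) : ℕ → Submodule ℂ V
  | 0 => W
  | j + 1 => hullStep x W j ⊔ (hullStep x W j).map x

/-- The smallest subspace containing `W` and stable under `x`. -/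
def hull (x : Module.End ℂ V) (W : Submodule ℂ V) : Submodule ℂ V := ⨆ j, hullStep x W j

variable {x y : Module.End ℂ V} {W : Submodule ℂ V}

theorem hullStep_mono : Monotone (hullStep x W) :=
  monotone_nat_of_le_succ fun _ => le_sup_left

theorem mem_hull {v : V} : v ∈ hull x W ↔ ∃ j, v ∈ hullStep x W j :=
  Submodule.mem_iSup_of_directed _ hullStep_mono.directed_le

theorem le_hull : W ≤ hull x W := le_iSup (hullStep x W) 0

theorem apply_mem_hullStep {v : V} {j : ℕ} (hv : v ∈ hullStep x W j) :
    x v ∈ hullStep x W (j + 1) :=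
  Submodule.mem_sup_right (Submodule.mem_map_of_mem hv)

theorem apply_mem_hull {v : V} (hv : v ∈ hull x W) : x v ∈ hull x W := by
  obtain ⟨j, hj⟩ := mem_hull.1 hv
  exact mem_hull.2 ⟨j + 1, apply_mem_hullStep hj⟩

theorem hull_induction {p : V → Prop} (mem : ∀ w ∈ W, p w) (add : ∀ u v, p u → p v → p (u + v))
    (apply : ∀ v ∈ hull x W, p v → p (x v)) {v : V} (hv : v ∈ hull x W) : p v := by
  obtain ⟨j, hj⟩ := mem_hull.1 hv
  induction j generalizing v with
  | zero => exact mem v hj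
  | succ j ih =>
    obtain ⟨u, hu, _, ⟨w, hw, rfl⟩, rfl⟩ := Submodule.mem_sup.1 hj
    have hw' := mem_hull.2 ⟨j, hw⟩
    exact add _ _ (ih (mem_hull.2 ⟨j, hu⟩) hu) (apply _ hw' (ih hw' hw))

/-- With `W` as constants, `x` and `y` behave like a variable and t times its derivative: `y` lowers
the degree, and modulo lower degree x y is t times the number operator. Both halves are needed in
the induction, since a vector of degree j + 1 has a component of lower degree to control. The
truncated j - 1 is harmless at j = 0 because `y` kills `W`. -/
theorem hullStep_lower {t : ℂ} (hy : ∀ w ∈ W, y w = 0)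
    (hyx : ∀ v ∈ hull x W, y (x v) = x (y v) + t • v) (j : ℕ) :
    (∀ v ∈ hullStep x W j, y v ∈ hullStep x W (j - 1) ∧ x (y v) ∈ hullStep x W j) ∧
    (∀ v ∈ hullStep x W (j + 1), y v ∈ hullStep x W j ∧
      x (y v) - ((j + 1 : ℕ) * t) • v ∈ hullStep x W j) := by
  induction j with
  | zero =>
    have h0 : ∀ v ∈ hullStep x W 0, y v = 0 := hy
    refine ⟨fun v hv => by simp [h0 v hv], fun v hv => ?_⟩
    obtain ⟨u, hu, _, ⟨w, hw, rfl⟩, rfl⟩ := Submodule.mem_sup.1 hv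
    have hw' := hyx w (mem_hull.2 ⟨0, hw⟩)
    simp only [map_add, h0 u hu, hw', h0 w hw, map_zero, zero_add, map_smul, Nat.cast_one, one_mul,
      smul_add]
    refine ⟨Submodule.smul_mem _ _ hw, ?_⟩
    convert Submodule.smul_mem _ (-t) hu using 1
    module
  | succ j ih =>
    obtain ⟨-, ih⟩ := ih
    have h1 : ∀ v ∈ hullStep x W (j + 1), y v ∈ hullStep x W (j + 1 - 1) ∧
        x (y v) ∈ hullStep x W (j + 1) := fun v hv =>
      ⟨(ih v hv).1, apply_mem_hullStep (ih v hv).1⟩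
    refine ⟨h1, fun v hv => ?_⟩
    obtain ⟨u, hu, _, ⟨w, hw, rfl⟩, rfl⟩ := Submodule.mem_sup.1 hv
    have hw' := hyx w (mem_hull.2 ⟨_, hw⟩)
    constructor
    · rw [map_add, hw']
      exact add_mem (hullStep_mono (Nat.le_succ j) (h1 u hu).1)
        (add_mem (h1 w hw).2 (Submodule.smul_mem _ _ hw))
    · have h2 : x (y (u + x w)) - ((j + 1 + 1 : ℕ) * t) • (u + x w) =
          x (y u) - ((j + 1 + 1 : ℕ) * t) • u + x (x (y w) - ((j + 1 : ℕ) * t) • w) := by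
        simp only [map_add, hw', map_sub, map_smul]
        push_cast
        module
      rw [h2]
      exact add_mem (sub_mem (h1 u hu).2 (Submodule.smul_mem _ _ hu))
        (apply_mem_hullStep (ih w hw).2)

/-- If `y` annihilates `W` and `[y, x]` is a nonzero scalar on `hull x W`, then a suitable power of
`y` maps a given nonzero vector of `hull x W` to a nonzero vector of `W`. -/
theorem exists_pow_apply_mem {t : ℂ} (ht : t ≠ 0) (hy : ∀ w ∈ W, y w = 0)
    (hyx : ∀ v ∈ hull x W, y (x v) = x (y v) + t • v) {v : V} (hv : v ∈ hull x W) (h0 : v ≠ 0) :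
    ∃ r : ℕ, (y ^ r) v ∈ W ∧ (y ^ r) v ≠ 0 := by
  obtain ⟨j, hj⟩ := mem_hull.1 hv
  clear hv
  induction j generalizing v with
  | zero => exact ⟨0, hj, h0⟩
  | succ j ih =>
    obtain ⟨h1, h2⟩ := (hullStep_lower hy hyx j).2 v hj
    by_cases hyv : y v = 0
    -- If `y v = 0`, the congruence x (y v) ≡ (j + 1) t v shows that v already has degree at most j.
    · refine ih h0 ?_
      rw [hyv, map_zero, zero_sub, neg_mem_iff] at h2
      exact (Submodule.smul_mem_iff _ (mul_ne_zero (Nat.cast_ne_zero.2 j.succ_ne_zero) ht)).1 h2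
    · obtain ⟨r, hr⟩ := ih hyv h1
      exact ⟨r + 1, by simpa only [pow_succ, Module.End.mul_apply] using hr⟩

/-- The subspaces obtained from `W` by applying `x 0`, then `x 1`, and so on. -/
def tower (x : ℕ → Module.End ℂ V) (W : Submodule ℂ V) : ℕ → Submodule ℂ V
  | 0 => W
  | n + 1 => hull (x n) (tower x W n)

/-- The union of the subspaces `tower x W n`. -/
def towerTop (x : ℕ → Module.End ℂ V) (W : Submodule ℂ V) : Submodule ℂ V := ⨆ n, tower x W n

variable {x y : ℕ → Module.End ℂ V}

theorem tower_mono : Monotone (tower x W) := monotone_nat_of_le_succ fun _ => le_hull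

theorem mem_towerTop {v : V} : v ∈ towerTop x W ↔ ∃ n, v ∈ tower x W n :=
  Submodule.mem_iSup_of_directed _ tower_mono.directed_le

theorem le_towerTop : W ≤ towerTop x W := le_iSup (tower x W) 0

theorem towerTop_induction {p : V → Prop} (mem : ∀ w ∈ W, p w)
    (add : ∀ u v, p u → p v → p (u + v)) (apply : ∀ n v, p v → p (x n v))
    {v : V} (hv : v ∈ towerTop x W) : p v := by
  obtain ⟨n, hn⟩ := mem_towerTop.1 hv
  clear hv
  induction n generalizing v with
  | zero => exact mem v hn
  | succ n ih => exact hull_induction (fun w hw => ih hw) add (fun v _ => apply n v) hn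

/-- Since T x = x T + [T, x], stability of one level passes to the next as soon as the commutator
with the newly adjoined operator preserves that level. -/
theorem apply_mem_tower {T : Module.End ℂ V} {n : ℕ} (h0 : ∀ v ∈ tower x W n, T v ∈ tower x W n)
    (h : ∀ m, n ≤ m → ∀ v ∈ tower x W (m + 1), T (x m v) - x m (T v) ∈ tower x W (m + 1))
    {m : ℕ} (hm : n ≤ m) {v : V} (hv : v ∈ tower x W m) : T v ∈ tower x W m := by
  induction m, hm using Nat.le_induction generalizing v with
  | base => exact h0 v hv
  | succ m hm ih =>
    refine hull_induction (p := fun v => T v ∈ tower x W (m + 1)) (fun w hw => le_hull (ih hw))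
      (fun u v hu hv => by rw [map_add]; exact add_mem hu hv) (fun v hv' hv => ?_) hv
    rw [← sub_add_cancel (T (x m v)) (x m (T v))]
    exact add_mem (h m hm v hv') (apply_mem_hull hv)

theorem apply_mem_towerTop (hx : ∀ m n v, x m (x n v) = x n (x m v)) (n : ℕ) {v : V}
    (hv : v ∈ towerTop x W) : x n v ∈ towerTop x W := by
  obtain ⟨m, hm⟩ := mem_towerTop.1 hv
  -- Level n + 1 is the first one stable under `x n` by construction; later operators commute with
  -- `x n`.
  refine mem_towerTop.2 ⟨max (n + 1) m, ?_⟩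
  refine apply_mem_tower (n := n + 1) (fun v hv => apply_mem_hull hv) (fun m _ v _ => ?_)
    (le_max_left _ _) (tower_mono (le_max_right _ _) hm)
  rw [hx, sub_self]
  exact zero_mem _

/-- A nonzero subspace of the union of a tower that is stable under the annihilation operators
meets the bottom of the tower. -/
theorem exists_mem_bot {t : ℕ → ℂ} (ht : ∀ n, t n ≠ 0)
    (hy : ∀ n, ∀ w ∈ tower x W n, y n w = 0)
    (hyx : ∀ n, ∀ v ∈ tower x W (n + 1), y n (x n v) = x n (y n v) + t n • v)
    {N : Submodule ℂ V} (hN : ∀ n, ∀ v ∈ N, y n v ∈ N)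
    (h : ∃ v ∈ N, v ∈ towerTop x W ∧ v ≠ 0) : ∃ v ∈ N, v ∈ W ∧ v ≠ 0 := by
  obtain ⟨v, hvN, hv, h0⟩ := h
  obtain ⟨n, hn⟩ := mem_towerTop.1 hv
  clear hv
  induction n generalizing v with
  | zero => exact ⟨v, hvN, hn, h0⟩
  | succ n ih =>
    -- A power of `y n` removes the outermost operator `x n` and keeps the vector nonzero; stability
    -- of `N` keeps it in `N`.
    obtain ⟨r, hr, hr0⟩ := exists_pow_apply_mem (ht n) (hy n) (hyx n) hn h0
    refine ih _ ?_ hr0 hr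
    clear hr hr0
    induction r with
    | zero => exact hvN
    | succ r ih => rw [pow_succ', Module.End.mul_apply]; exact hN n _ ih

end Hull

/-! ### Representations given by mode operators -/

/-- The sign `(-1)ⁿ`, as a complex number. -/
def sgn (n : ℤ) : ℂ := (-1) ^ n

theorem sgn_ne_zero (n : ℤ) : sgn n ≠ 0 := zpow_ne_zero _ (by norm_num)

theorem sgn_add (m n : ℤ) : sgn (m + n) = sgn m * sgn n := zpow_add₀ (by norm_num) m n

theorem sgn_odd {n : ℤ} (h : Odd n) : sgn n = -1 := h.neg_one_zpow

theorem sgn_even {n : ℤ} (h : Even n) : sgn n = 1 := h.neg_one_zpow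

theorem sgn_mul_self (n : ℤ) : sgn n * sgn n = 1 := by
  rw [← sgn_add, sgn_even (Even.add_self n)]

/-- Operators `A n`, `C n`, `D n` on `V` satisfying the relations of the twisted affine algebra, with
`k` acting as `ξ`. Here `A n` stands for `(a + (-1)ⁿ b)(n)`; `C n` and `D n` vanish for even `n`. -/
structure ModeRep (V : Type*) [AddCommGroup V] [Module ℂ V] (ξ : ℂ) where
  A : ℤ → Module.End ℂ V
  C : ℤ → Module.End ℂ V
  D : ℤ → Module.End ℂ V
  C_even : ∀ n, Even n → C n = 0
  D_even : ∀ n, Even n → D n = 0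
  A_A : ∀ m n v, A m (A n v) - A n (A m v) =
    (-2 * sgn m) • C (m + n) v + (if m + n = 0 then 2 * m * sgn m * ξ else 0) • v
  A_C : ∀ m n v, A m (C n v) = C n (A m v)
  C_C : ∀ m n v, C m (C n v) = C n (C m v)
  D_D : ∀ m n v, D m (D n v) = D n (D m v)
  D_A : ∀ m n v, Odd m → D m (A n v) - A n (D m v) = A (m + n) v
  D_C : ∀ m n v, Odd m → D m (C n v) - C n (D m v) = (if m + n = 0 then m * ξ else 0) • v

namespace ModeRep

variable {V : Type*} [AddCommGroup V] [Module ℂ V] {ξ : ℂ} (ρ : ModeRep V ξ)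

/-- A subspace stable under all modes. -/
def Stable (N : Submodule ℂ V) : Prop :=
  ∀ n, ∀ v ∈ N, ρ.A n v ∈ N ∧ ρ.C n v ∈ N ∧ ρ.D n v ∈ N

/-- A vector annihilated by the positive modes. -/
def IsSingular (v : V) : Prop := ∀ n, 0 < n → ρ.A n v = 0 ∧ ρ.C n v = 0 ∧ ρ.D n v = 0

/-- The span of the vectors `(A 0)ⁿ ω`. -/
def zeroHull (ω : V) : Submodule ℂ V := hull (ρ.A 0) (ℂ ∙ ω)

/-- The subspace generated from `zeroHull` by the negative modes of `C`. -/
def cHull (ω : V) : Submodule ℂ V := towerTop (fun n => ρ.C (-(2 * n + 1))) (ρ.zeroHull ω)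

/-- The subspace generated from `cHull` by the negative modes of `A`. -/
def aHull (ω : V) : Submodule ℂ V := towerTop (fun n => ρ.A (-(n + 1))) (ρ.cHull ω)

/-- The subspace generated from `aHull` by the negative modes of `D`. -/
def dHull (ω : V) : Submodule ℂ V := towerTop (fun n => ρ.D (-(2 * n + 1))) (ρ.aHull ω)

theorem odd_index (n : ℕ) : Odd (-(2 * n + 1) : ℤ) := (odd_two_mul_add_one (n : ℤ)).neg

theorem exists_index {n : ℤ} (hn : n < 0) (h : Odd n) : ∃ m : ℕ, n = -(2 * m + 1) := by
  obtain ⟨j, rfl⟩ := h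
  exact ⟨(-j - 1).toNat, by omega⟩

/-! ### The hulls of a singular vector, and descent through them -/

section

variable {ρ} {ω : V} (hω : ρ.IsSingular ω)
include hω

theorem isSingular_of_mem_zeroHull {v : V} (hv : v ∈ ρ.zeroHull ω) : ρ.IsSingular v := by
  refine hull_induction (fun w hw n hn => ?_) (fun u v hu hv n hn => ?_) (fun v _ h n hn => ?_) hv
  · obtain ⟨t, rfl⟩ := Submodule.mem_span_singleton.1 hw
    simp [hω n hn]
  · simp [hu n hn, hv n hn]
  · obtain ⟨h1, h2, h3⟩ := h n hn
    refine ⟨?_, ?_, ?_⟩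
    · have := ρ.A_A n 0 v
      rwa [h1, add_zero, h2, if_neg hn.ne', map_zero, sub_zero, smul_zero, zero_smul,
        add_zero] at this
    · rw [← ρ.A_C, h2, map_zero]
    · rcases Int.even_or_odd n with he | ho
      · rw [ρ.D_even n he, LinearMap.zero_apply]
      · have := ρ.D_A n 0 v ho
        rwa [h3, add_zero, h1, map_zero, sub_zero] at this

theorem C_pos_aHull {n : ℤ} (hn : 0 < n) {v : V} (hv : v ∈ ρ.aHull ω) : ρ.C n v = 0 := by
  refine towerTop_induction (p := fun v => ρ.C n v = 0) (fun w hw => ?_) (fun u v hu hv => by simp [hu, hv])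
    (fun m v h => by rw [← ρ.A_C, h, map_zero]) hv
  refine towerTop_induction (p := fun v => ρ.C n v = 0) (fun w hw => ?_) (fun u v hu hv => by simp [hu, hv])
    (fun m v h => by rw [ρ.C_C, h, map_zero]) hw
  exact (isSingular_of_mem_zeroHull hω hw n hn).2.1

theorem A_pos_cHull {n : ℤ} (hn : 0 < n) {v : V} (hv : v ∈ ρ.cHull ω) : ρ.A n v = 0 :=
  towerTop_induction (fun w hw => (isSingular_of_mem_zeroHull hω hw n hn).1)
    (fun u v hu hv => by simp [hu, hv]) (fun m v h => by rw [ρ.A_C, h, map_zero]) hv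

theorem C_mem_cHull (n : ℤ) {v : V} (hv : v ∈ ρ.cHull ω) : ρ.C n v ∈ ρ.cHull ω := by
  rcases Int.even_or_odd n with he | ho
  · rw [ρ.C_even n he]; exact zero_mem _
  rcases le_or_gt n 0 with h | h
  · obtain ⟨m, rfl⟩ := exists_index (by rcases ho with ⟨j, rfl⟩; omega) ho
    exact apply_mem_towerTop (x := fun n : ℕ => ρ.C (-(2 * n + 1))) (fun _ _ => ρ.C_C _ _) m hv
  · rw [C_pos_aHull hω h (le_towerTop hv)]; exact zero_mem _

theorem A_mem_cHull {n : ℤ} (hn : 0 ≤ n) {v : V} (hv : v ∈ ρ.cHull ω) : ρ.A n v ∈ ρ.cHull ω := by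
  rcases hn.lt_or_eq with h | rfl
  · rw [A_pos_cHull hω h hv]; exact zero_mem _
  · refine towerTop_induction (p := fun v => ρ.A 0 v ∈ ρ.cHull ω)
      (fun w hw => le_towerTop (apply_mem_hull hw))
      (fun u v hu hv => by rw [map_add]; exact add_mem hu hv) (fun m v h => ?_) hv
    rw [ρ.A_C]
    exact C_mem_cHull hω _ h

theorem D_mem_cHull {n : ℤ} (hn : 0 < n) {v : V} (hv : v ∈ ρ.cHull ω) : ρ.D n v ∈ ρ.cHull ω := by
  rcases Int.even_or_odd n with he | ho
  · rw [ρ.D_even n he]; exact zero_mem _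
  obtain ⟨m, hm⟩ := mem_towerTop.1 hv
  refine mem_towerTop.2 ⟨m, apply_mem_tower (n := 0) (fun v hv => ?_) (fun m _ v hv => ?_)
    (Nat.zero_le m) hm⟩
  · rw [(isSingular_of_mem_zeroHull hω hv n hn).2.2]; exact zero_mem _
  · rw [ρ.D_C _ _ _ ho]; exact Submodule.smul_mem _ _ hv

theorem C_mem_aTower (n : ℤ) (m : ℕ) {v : V}
    (hv : v ∈ tower (fun n => ρ.A (-(n + 1))) (ρ.cHull ω) m) :
    ρ.C n v ∈ tower (fun n => ρ.A (-(n + 1))) (ρ.cHull ω) m := by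
  refine apply_mem_tower (n := 0) (fun v hv => C_mem_cHull hω n hv) (fun m _ v hv => ?_)
    (Nat.zero_le m) hv
  rw [ρ.A_C, sub_self]; exact zero_mem _

/-- The bound -m ≤ n reflects that A(-j) is adjoined in passing to level j. The operators adjoined
later commute with A(n) up to modes of C and scalars, which preserve every level. -/
theorem A_mem_aTower {n : ℤ} (m : ℕ) (hn : -m ≤ n) {v : V}
    (hv : v ∈ tower (fun n => ρ.A (-(n + 1))) (ρ.cHull ω) m) :
    ρ.A n v ∈ tower (fun n => ρ.A (-(n + 1))) (ρ.cHull ω) m := by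
  have key : ∀ m, ∀ v ∈ tower (fun n => ρ.A (-(n + 1))) (ρ.cHull ω) (m + 1),
      ρ.A n (ρ.A (-(m + 1)) v) - ρ.A (-(m + 1)) (ρ.A n v) ∈
        tower (fun n => ρ.A (-(n + 1))) (ρ.cHull ω) (m + 1) := fun m v hv => by
    rw [ρ.A_A]
    exact add_mem (Submodule.smul_mem _ _ (C_mem_aTower hω _ _ hv)) (Submodule.smul_mem _ _ hv)
  rcases le_or_gt 0 n with h | h
  · exact apply_mem_tower (n := 0) (fun v hv => A_mem_cHull hω h hv) (fun m _ => key m)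
      (Nat.zero_le m) hv
  · obtain ⟨j, rfl⟩ : ∃ j : ℕ, n = -(j + 1) := ⟨(-n - 1).toNat, by omega⟩
    exact apply_mem_tower (n := j + 1) (fun v hv => apply_mem_hull hv) (fun m _ => key m)
      (by omega) hv

theorem C_mem_aHull (n : ℤ) {v : V} (hv : v ∈ ρ.aHull ω) : ρ.C n v ∈ ρ.aHull ω := by
  obtain ⟨m, hm⟩ := mem_towerTop.1 hv
  exact mem_towerTop.2 ⟨m, C_mem_aTower hω n m hm⟩

theorem A_mem_aHull (n : ℤ) {v : V} (hv : v ∈ ρ.aHull ω) : ρ.A n v ∈ ρ.aHull ω := by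
  obtain ⟨m, hm⟩ := mem_towerTop.1 hv
  exact mem_towerTop.2 ⟨max m n.natAbs, A_mem_aTower hω _ (by omega)
    (tower_mono (le_max_left _ _) hm)⟩

theorem D_mem_aHull {n : ℤ} (hn : 0 < n) {v : V} (hv : v ∈ ρ.aHull ω) : ρ.D n v ∈ ρ.aHull ω := by
  rcases Int.even_or_odd n with he | ho
  · rw [ρ.D_even n he]; exact zero_mem _
  -- Membership of v is carried along because moving D(n) past A(-(m+1)) leaves the term A(n-m-1) v.
  refine towerTop_induction (p := fun v => v ∈ ρ.aHull ω ∧ ρ.D n v ∈ ρ.aHull ω)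
    (fun w hw => ⟨le_towerTop hw, le_towerTop (D_mem_cHull hω hn hw)⟩)
    (fun u v hu hv => by rw [map_add]; exact ⟨add_mem hu.1 hv.1, add_mem hu.2 hv.2⟩)
    (fun m v h => ⟨A_mem_aHull hω _ h.1, ?_⟩) hv |>.2
  rw [← sub_add_cancel (ρ.D n _) (ρ.A (-(m + 1)) (ρ.D n v)), ρ.D_A _ _ _ ho]
  exact add_mem (A_mem_aHull hω _ h.1) (A_mem_aHull hω _ h.2)

/-- This is the spanning half of a PBW theorem: modes can be reordered so that the D's stand
leftmost, then the A's, then the C's. The order is forced by [A, A] producing C and [D, A] producing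
A, so each hull is stable under what the next one needs. -/
theorem stable_dHull : ρ.Stable (ρ.dHull ω) := by
  have hD : ∀ n, ∀ v ∈ ρ.dHull ω, ρ.D n v ∈ ρ.dHull ω := fun n v hv => by
    rcases Int.even_or_odd n with he | ho
    · rw [ρ.D_even n he]; exact zero_mem _
    rcases le_or_gt n 0 with h | h
    · obtain ⟨m, rfl⟩ := exists_index (by rcases ho with ⟨j, rfl⟩; omega) ho
      exact apply_mem_towerTop (x := fun n : ℕ => ρ.D (-(2 * n + 1))) (fun _ _ => ρ.D_D _ _) m hv
    · obtain ⟨m, hm⟩ := mem_towerTop.1 hv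
      refine mem_towerTop.2 ⟨m, apply_mem_tower (n := 0) (fun v hv => D_mem_aHull hω h hv)
        (fun m _ v _ => ?_) (Nat.zero_le m) hm⟩
      rw [ρ.D_D, sub_self]; exact zero_mem _
  -- All indices n are treated at once because [D(m), A(n)] shifts the index, and v itself is
  -- included for the scalar commutator [D, C].
  have hAC : ∀ v ∈ ρ.dHull ω, v ∈ ρ.dHull ω ∧ ∀ n, ρ.A n v ∈ ρ.dHull ω ∧ ρ.C n v ∈ ρ.dHull ω := by
    intro v hv
    refine towerTop_induction (p := fun v => v ∈ ρ.dHull ω ∧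
        ∀ n, ρ.A n v ∈ ρ.dHull ω ∧ ρ.C n v ∈ ρ.dHull ω)
      (fun w hw => ⟨le_towerTop hw, fun n => ⟨le_towerTop (A_mem_aHull hω n hw),
        le_towerTop (C_mem_aHull hω n hw)⟩⟩)
      (fun u v hu hv => ⟨add_mem hu.1 hv.1, fun n => ?_⟩)
      (fun m v h => ⟨hD _ _ h.1, fun n => ⟨?_, ?_⟩⟩) hv
    · rw [map_add, map_add]
      exact ⟨add_mem (hu.2 n).1 (hv.2 n).1, add_mem (hu.2 n).2 (hv.2 n).2⟩
    · rw [← sub_sub_cancel (ρ.D (-(2 * m + 1)) (ρ.A n v)) (ρ.A n _), ρ.D_A _ _ _ (odd_index m)]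
      exact sub_mem (hD _ _ (h.2 n).1) (h.2 _).1
    · rw [← sub_sub_cancel (ρ.D (-(2 * m + 1)) (ρ.C n v)) (ρ.C n _), ρ.D_C _ _ _ (odd_index m)]
      exact sub_mem (hD _ _ (h.2 n).2) (Submodule.smul_mem _ _ h.1)
  exact fun n v hv => ⟨((hAC v hv).2 n).1, ((hAC v hv).2 n).2, hD n v hv⟩

/-- D(2n+1) is conjugate to C(-(2n+1)), commutes with the earlier C(-(2m+1)), m < n, and kills
`zeroHull`. So it annihilates the level to which C(-(2n+1)) is adjoined. -/
theorem exists_mem_cHull (hξ : ξ ≠ 0) {N : Submodule ℂ V} (hN : ρ.Stable N)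
    (h : ∃ v ∈ N, v ∈ ρ.cHull ω ∧ v ≠ 0) : ∃ v ∈ N, v ∈ ρ.zeroHull ω ∧ v ≠ 0 := by
  have ho : ∀ n : ℕ, Odd (2 * n + 1 : ℤ) := fun n => odd_two_mul_add_one _
  refine exists_mem_bot (y := fun n => ρ.D (2 * n + 1)) (t := fun n => (2 * n + 1) * ξ)
    (fun n => mul_ne_zero (by norm_cast) hξ) (fun n w hw => ?_) (fun n v _ => ?_)
    (fun n v hv => (hN _ v hv).2.2) h
  · suffices ∀ m ≤ n, ∀ w ∈ tower (fun n => ρ.C (-(2 * n + 1))) (ρ.zeroHull ω) m,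
      ρ.D (2 * n + 1) w = 0 from this n le_rfl w hw
    intro m hm
    induction m with
    | zero => exact fun w hw => (isSingular_of_mem_zeroHull hω hw _ (by omega)).2.2
    | succ m ih =>
      refine fun w hw => hull_induction (fun w hw => ih (by omega) w hw)
        (fun u v hu hv => by simp [hu, hv]) (fun v _ hv => ?_) hw
      have := ρ.D_C (2 * n + 1) (-(2 * m + 1)) v (ho n)
      rwa [hv, if_neg (by omega), zero_smul, map_zero, sub_zero] at this
  · have := ρ.D_C (2 * n + 1) (-(2 * n + 1)) v (ho n)
    rw [if_pos (by omega), sub_eq_iff_eq_add'] at this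
    rw [this]
    push_cast
    rfl

/-- Here the order of the tower matters. Moving A(n+1) past A(-(m+1)) produces C(n-m), which kills
`aHull` when m < n. Thus A(n+1) annihilates level n, where only A(-1), …, A(-n) have been adjoined.
-/
theorem exists_mem_aHull (hξ : ξ ≠ 0) {N : Submodule ℂ V} (hN : ρ.Stable N)
    (h : ∃ v ∈ N, v ∈ ρ.aHull ω ∧ v ≠ 0) : ∃ v ∈ N, v ∈ ρ.cHull ω ∧ v ≠ 0 := by
  refine exists_mem_bot (y := fun n => ρ.A (n + 1))
    (t := fun n => 2 * (n + 1) * sgn (n + 1) * ξ)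
    (fun n => mul_ne_zero (mul_ne_zero (mul_ne_zero two_ne_zero (by norm_cast)) (sgn_ne_zero _)) hξ)
    (fun n w hw => ?_) (fun n v _ => ?_) (fun n v hv => (hN _ v hv).1) h
  · suffices ∀ m ≤ n, ∀ w ∈ tower (fun n => ρ.A (-(n + 1))) (ρ.cHull ω) m,
      ρ.A (n + 1) w = 0 from this n le_rfl w hw
    intro m hm
    induction m with
    | zero => exact fun w hw => A_pos_cHull hω (by omega) hw
    | succ m ih =>
      refine fun w hw => hull_induction (p := fun w => ρ.A (n + 1) w = 0)
        (fun w hw => ih (by omega) w hw)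
        (fun u v hu hv => by simp [hu, hv]) (fun v hv' hv => ?_) hw
      have := ρ.A_A (n + 1) (-(m + 1)) v
      rwa [hv, if_neg (by omega), zero_smul, map_zero, sub_zero, C_pos_aHull hω (by omega)
        (mem_towerTop.2 ⟨m + 1, hv'⟩), smul_zero, zero_add] at this
  · have := ρ.A_A (n + 1) (-(n + 1)) v
    -- The commutator of A(n+1) and A(-(n+1)) also contains C(0), which vanishes because 0 is even.
    rw [if_pos (by omega), sub_eq_iff_eq_add', ρ.C_even _ (by simp), LinearMap.zero_apply,
      smul_zero, zero_add] at this
    rw [this]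
    push_cast
    rfl

/-- C(2n+1) kills all of `aHull`, since it commutes with the A's and C's, and among the negative
modes of D it fails to commute only with D(-(2n+1)). -/
theorem exists_mem_dHull (hξ : ξ ≠ 0) {N : Submodule ℂ V} (hN : ρ.Stable N)
    (h : ∃ v ∈ N, v ∈ ρ.dHull ω ∧ v ≠ 0) : ∃ v ∈ N, v ∈ ρ.aHull ω ∧ v ≠ 0 := by
  refine exists_mem_bot (y := fun n => ρ.C (2 * n + 1)) (t := fun n => (2 * n + 1) * ξ)
    (fun n => mul_ne_zero (by norm_cast) hξ) (fun n w hw => ?_) (fun n v _ => ?_)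
    (fun n v hv => (hN _ v hv).2.1) h
  · suffices ∀ m ≤ n, ∀ w ∈ tower (fun n => ρ.D (-(2 * n + 1))) (ρ.aHull ω) m,
      ρ.C (2 * n + 1) w = 0 from this n le_rfl w hw
    intro m hm
    induction m with
    | zero => exact fun w hw => C_pos_aHull hω (by omega) hw
    | succ m ih =>
      refine fun w hw => hull_induction (fun w hw => ih (by omega) w hw)
        (fun u v hu hv => by simp [hu, hv]) (fun v _ hv => ?_) hw
      have := ρ.D_C (-(2 * m + 1)) (2 * n + 1) v (odd_index m)
      rwa [hv, if_neg (by omega), zero_smul, map_zero, zero_sub, neg_eq_zero] at this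
  · have := ρ.D_C (-(2 * n + 1)) (2 * n + 1) v (odd_index n)
    rw [if_pos (by omega), sub_eq_iff_eq_add, ← sub_eq_iff_eq_add'] at this
    rw [← this, sub_eq_add_neg, ← neg_smul]
    push_cast
    congr 2
    ring

/-- If the singular vector `ω` generates `V`, every nonzero stable subspace contains a nonzero
vector of the form `f(A 0) ω`. -/
theorem exists_aeval_mem (hξ : ξ ≠ 0) (hgen : ∀ N, ρ.Stable N → ω ∈ N → N = ⊤)
    {N : Submodule ℂ V} (hN : ρ.Stable N) (h0 : N ≠ ⊥) :
    ∃ f : Polynomial ℂ, Polynomial.aeval (ρ.A 0) f ω ∈ N ∧ Polynomial.aeval (ρ.A 0) f ω ≠ 0 := by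
  have hω' : ω ∈ ρ.dHull ω := le_towerTop (le_towerTop (le_towerTop (le_hull
    (Submodule.mem_span_singleton_self ω))))
  obtain ⟨v, hv, hv0⟩ := N.ne_bot_iff.1 h0
  obtain ⟨w, hw, hw', hw0⟩ := exists_mem_cHull hω hξ hN <| exists_mem_aHull hω hξ hN <|
    exists_mem_dHull hω hξ hN ⟨v, hv, by rw [hgen _ (stable_dHull hω) hω']; trivial, hv0⟩
  obtain ⟨f, rfl⟩ : ∃ f : Polynomial ℂ, Polynomial.aeval (ρ.A 0) f ω = w := by
    refine hull_induction (p := fun w => ∃ f : Polynomial ℂ, Polynomial.aeval (ρ.A 0) f ω = w)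
      (fun w hw => ?_) ?_ ?_ hw'
    · obtain ⟨t, rfl⟩ := Submodule.mem_span_singleton.1 hw
      exact ⟨Polynomial.C t, by simp⟩
    · rintro _ _ ⟨f, rfl⟩ ⟨g, rfl⟩
      exact ⟨f + g, by simp⟩
    · rintro _ - ⟨f, rfl⟩
      exact ⟨Polynomial.X * f, by simp⟩
  exact ⟨f, hw, hw0⟩

end
end ModeRep

/-! ### Exponentials of commuting modes -/

section Exp

open Finset PowerSeries

variable {R : Type*} [Ring R]

/-- The operator `w d/dw` on power series. -/
def eulerOp (f : PowerSeries R) : PowerSeries R := PowerSeries.mk fun n => (n : R) * coeff n f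

theorem coeff_eulerOp (f : PowerSeries R) (n : ℕ) : coeff n (eulerOp f) = n * coeff n f :=
  coeff_mk _ _

theorem eulerOp_mul (f g : PowerSeries R) : eulerOp (f * g) = eulerOp f * g + f * eulerOp g := by
  ext n
  simp only [coeff_eulerOp, map_add, coeff_mul, mul_sum, ← sum_add_distrib]
  refine sum_congr rfl fun x hx => ?_
  rw [← mem_antidiagonal.1 hx, Nat.cast_add, add_mul, ← mul_assoc, ← mul_assoc, ← mul_assoc,
    ← (Nat.cast_commute x.2 (coeff x.1 f)).eq, mul_assoc (x.2 : R)]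

theorem eulerOp_sub (f g : PowerSeries R) : eulerOp (f - g) = eulerOp f - eulerOp g := by
  ext n
  simp only [coeff_eulerOp, map_sub, mul_sub]

variable [Algebra ℂ R] (c : ℕ → R)

theorem eq_zero_of_natCast_mul {n : ℕ} (hn : n ≠ 0) {x : R} (h : (n : R) * x = 0) : x = 0 := by
  have h1 : (n : ℂ) • x = 0 := by rw [Algebra.smul_def, map_natCast, h]
  exact (smul_eq_zero_iff_right (Nat.cast_ne_zero.2 hn)).1 h1

/-- The coefficients of `exp (∑ⱼ c j wʲ / j)`. -/
def expCoeff : ℕ → R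
  | 0 => 1
  | n + 1 => ((n + 1 : ℕ) : ℂ)⁻¹ • ∑ i : Fin (n + 1), c (n + 1 - i) * expCoeff i

variable {c}

/-- The recursion defining `expCoeff` is this differential equation read coefficientwise; the term
absent from the recursion has factor `c 0 = 0`. Since `c` always stands on the left, its values need
not commute. -/
theorem eulerOp_exp (hc : c 0 = 0) :
    eulerOp (PowerSeries.mk (expCoeff c)) = PowerSeries.mk c * PowerSeries.mk (expCoeff c) := by
  ext n
  rw [coeff_eulerOp, coeff_mul]
  simp only [coeff_mk]
  cases n with
  | zero => simp [hc]
  | succ n =>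
    rw [← Nat.sum_antidiagonal_swap]
    simp only [Prod.fst_swap, Prod.snd_swap]
    rw [Nat.sum_antidiagonal_eq_sum_range_succ (fun i j => c j * expCoeff c i), sum_range_succ,
      Nat.sub_self, hc, zero_mul, add_zero, expCoeff, ← map_natCast (algebraMap ℂ R),
      ← Algebra.smul_def, smul_smul, mul_inv_cancel₀ (Nat.cast_ne_zero.2 n.succ_ne_zero), one_smul,
      Fin.sum_univ_eq_sum_range (fun i => c (n + 1 - i) * expCoeff c i)]

/-- Uniqueness for w f' = c f: as `c 0 = 0`, the n-th coefficient of the right side involves only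
earlier coefficients of f. -/
theorem eq_zero_of_eulerOp (hc : c 0 = 0) {f : PowerSeries R} (h : eulerOp f = PowerSeries.mk c * f)
    (h0 : coeff 0 f = 0) : f = 0 := by
  ext n
  induction n using Nat.strong_induction_on with
  | _ n ih =>
    rcases eq_or_ne n 0 with rfl | hn
    · simpa using h0
    refine eq_zero_of_natCast_mul hn ?_
    rw [← coeff_eulerOp, h, coeff_mul]
    refine sum_eq_zero fun x hx => ?_
    have hx' := mem_antidiagonal.1 hx
    rcases eq_or_ne x.1 0 with h1 | h1
    · rw [h1, coeff_mk, hc, zero_mul]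
    · rw [ih x.2 (by omega), map_zero, mul_zero]

theorem commute_expCoeff {x : R} (hx : ∀ j, Commute x (c j)) (n : ℕ) :
    Commute x (expCoeff c n) := by
  induction n using Nat.strong_induction_on with
  | _ n ih =>
    cases n with
    | zero => rw [expCoeff]; exact Commute.one_right x
    | succ n =>
      rw [expCoeff]
      exact (Commute.sum_right _ _ _ fun (i : Fin (n + 1)) _ => (hx _).mul_right (ih i i.2)).smul_right _

/-- Since [x, c(w)] = r wʳ, bracketing with x multiplies the exponential E by wʳ. The difference [x,
E] - wʳ E solves the same equation as E and has zero constant term, so it vanishes by uniqueness;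
this avoids assuming that the `c j` commute with each other. -/
theorem commutator_expCoeff (hc : c 0 = 0) {x : R} {r : ℕ} (hr : 0 < r)
    (hx : ∀ j, x * c j - c j * x = if j = r then (r : R) else 0) (n : ℕ) :
    x * expCoeff c n - expCoeff c n * x = if r ≤ n then expCoeff c (n - r) else 0 := by
  set E : PowerSeries R := PowerSeries.mk (expCoeff c) with hE
  set c' : PowerSeries R := PowerSeries.mk c with hc'
  set x' : PowerSeries R := PowerSeries.C x
  have h1 : eulerOp E = c' * E := eulerOp_exp hc
  have h2 : eulerOp x' = 0 := by
    ext n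
    rw [coeff_eulerOp, coeff_C]
    split_ifs with h <;> simp [h]
  have h3 : eulerOp (X ^ r : PowerSeries R) = PowerSeries.C (r : R) * X ^ r := by
    ext n
    rw [coeff_eulerOp, coeff_C_mul, coeff_X_pow]
    split_ifs with h <;> simp [h]
  have h4 : x' * c' - c' * x' = PowerSeries.C (r : R) * X ^ r := by
    ext n
    rw [map_sub, coeff_C_mul, coeff_mul_C, coeff_C_mul, coeff_X_pow, hc', coeff_mk, hx]
    split_ifs <;> simp
  have h5 : X ^ r * c' = c' * X ^ r := (commute_X_pow c' r).symm.eq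
  have h6 : x' * E - E * x' - X ^ r * E = 0 := by
    refine eq_zero_of_eulerOp hc ?_ ?_
    · have h7 : X ^ r * (c' * E) = c' * (X ^ r * E) := by rw [← mul_assoc, h5, mul_assoc]
      have h8 : x' * (c' * E) = c' * (x' * E) + PowerSeries.C (r : R) * X ^ r * E := by
        rw [← h4]; noncomm_ring
      rw [eulerOp_sub, eulerOp_sub, eulerOp_mul, eulerOp_mul, eulerOp_mul, h1, h2, h3, zero_mul,
        mul_zero, ← hc', h7, h8]
      noncomm_ring
    · simp [hE, expCoeff, x', hr.ne']
  have h7 := congrArg (coeff n) h6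
  rw [map_sub, map_sub, coeff_C_mul, coeff_mul_C, coeff_X_pow_mul', map_zero, sub_eq_zero] at h7
  simpa [hE] using h7

/-- As c(w) has only odd terms, F(w) = E(-w) satisfies w F' = -c F. Hence F E has zero derivative
and equals 1, and (w F') E = -c. These two series identities are what closes the commutator of the
twisted modes. -/
theorem expCoeff_neg (hc : c 0 = 0) (hodd : ∀ j, Even j → c j = 0)
    (hcomm : ∀ i j, Commute (c i) (c j)) (n : ℕ) :
    ∑ x ∈ antidiagonal n, (-1 : R) ^ x.1 * (expCoeff c x.1 * expCoeff c x.2) =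
      (if n = 0 then 1 else 0) ∧
    ∑ x ∈ antidiagonal n, (-1 : R) ^ x.1 * x.1 * (expCoeff c x.1 * expCoeff c x.2) = -c n := by
  set E : PowerSeries R := PowerSeries.mk (expCoeff c) with hE
  set F : PowerSeries R := PowerSeries.mk fun n => (-1) ^ n * expCoeff c n with hF
  set c' : PowerSeries R := PowerSeries.mk c with hc'
  have h1 : eulerOp E = c' * E := eulerOp_exp hc
  have h2 : eulerOp F = -(c' * F) := by
    ext n
    have h := congrArg (coeff n) h1
    rw [coeff_eulerOp, coeff_mul] at h
    rw [coeff_eulerOp, map_neg, coeff_mul]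
    simp only [hE, hF, hc', coeff_mk] at h ⊢
    rw [← mul_assoc, (Nat.cast_commute n ((-1 : R) ^ n)).eq, mul_assoc, h, mul_sum, ← sum_neg_distrib]
    refine sum_congr rfl fun x hx => ?_
    rcases Nat.even_or_odd x.1 with he | ho
    · rw [hodd _ he]; simp
    · rw [← mem_antidiagonal.1 hx, pow_add, ho.neg_one_pow]
      rcases neg_one_pow_eq_or R x.2 with h | h <;> rw [h] <;> simp
  have h3 : F * c' = c' * F := by
    ext n
    rw [coeff_mul, coeff_mul, ← Nat.sum_antidiagonal_swap]
    refine sum_congr rfl fun x _ => ?_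
    simp only [Prod.fst_swap, Prod.snd_swap, hF, hc', coeff_mk]
    have := (commute_expCoeff (hcomm x.1) x.2).eq
    rcases neg_one_pow_eq_or R x.2 with h | h <;> rw [h] <;> simp [this]
  have h4 : F * E = 1 := by
    have h : eulerOp (F * E) = 0 := by
      rw [eulerOp_mul, h1, h2, ← mul_assoc, h3, ← add_mul, neg_add_cancel, zero_mul]
    ext n
    rcases eq_or_ne n 0 with rfl | hn
    · simp [hE, hF, expCoeff]
    · rw [coeff_one, if_neg hn]
      refine eq_zero_of_natCast_mul hn ?_
      rw [← coeff_eulerOp, h, map_zero]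
  have h5 : eulerOp F * E = -c' := by rw [h2, neg_mul, mul_assoc, h4, mul_one]
  constructor
  · have := congrArg (coeff n) h4
    rw [coeff_mul, coeff_one] at this
    simpa only [hE, hF, coeff_mk, mul_assoc] using this
  · have := congrArg (coeff n) h5
    rw [coeff_mul, map_neg] at this
    simp only [hE, hF, hc', coeff_mk, coeff_eulerOp] at this
    rw [← this]
    refine sum_congr rfl fun x _ => ?_
    rw [← (Nat.cast_commute x.1 ((-1 : R) ^ x.1)).eq, mul_assoc, mul_assoc, mul_assoc]

end Exp

/-! ### Twisting modes by an exponential -/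

section Twist

open Finset

variable {V : Type*} [AddCommGroup V] [Module ℂ V] {e : ℕ → Module.End ℂ V}
  {B : ℤ → Module.End ℂ V} {s : ℤ}

theorem finsum_eq_sum_range {M : Type*} [AddCommMonoid M] {f : ℕ → M} {K : ℕ}
    (h : ∀ p, K ≤ p → f p = 0) : ∑ᶠ p, f p = ∑ p ∈ range K, f p := by
  refine finsum_eq_sum_of_support_subset _ fun p hp => ?_
  rw [coe_range, Set.mem_Iio]
  by_contra hK
  exact hp (h p (not_lt.1 hK))

/-- The operators `∑ₚ e p B (n + s p)`. -/
def twist (hfin : ∀ n v, ∃ K, ∀ p, K ≤ p → e p (B (n + s * p) v) = 0) (n : ℤ) :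
    Module.End ℂ V where
  toFun v := ∑ᶠ p : ℕ, e p (B (n + s * p) v)
  map_add' u v := by
    obtain ⟨K, hK⟩ := hfin n u
    obtain ⟨L, hL⟩ := hfin n v
    have hK' : ∀ p, K ⊔ L ≤ p → e p (B (n + s * p) u) = 0 := fun p hp => hK p (by omega)
    have hL' : ∀ p, K ⊔ L ≤ p → e p (B (n + s * p) v) = 0 := fun p hp => hL p (by omega)
    rw [finsum_eq_sum_range hK', finsum_eq_sum_range hL', finsum_eq_sum_range (K := K ⊔ L),
      ← sum_add_distrib]
    · simp only [map_add]
    · intro p hp; rw [map_add, map_add, hK' p hp, hL' p hp, add_zero]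
  map_smul' t v := by
    simp only [map_smul, RingHom.id_apply]
    rw [← smul_finsum]

variable (hfin : ∀ n v, ∃ K, ∀ p, K ≤ p → e p (B (n + s * p) v) = 0)

theorem twist_apply {n : ℤ} {v : V} {K : ℕ} (h : ∀ p, K ≤ p → e p (B (n + s * p) v) = 0) :
    twist hfin n v = ∑ p ∈ range K, e p (B (n + s * p) v) := finsum_eq_sum_range h

theorem commute_twist {T : Module.End ℂ V} (he : ∀ p v, T (e p v) = e p (T v))
    (hB : ∀ n v, T (B n v) = B n (T v)) (n : ℤ) (v : V) :
    T (twist hfin n v) = twist hfin n (T v) := by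
  obtain ⟨K, hK⟩ := hfin n v
  have hK' : ∀ p, K ≤ p → e p (B (n + s * p) (T v)) = 0 := fun p hp => by
    rw [← hB, ← he, hK p hp, map_zero]
  rw [twist_apply hfin hK, twist_apply hfin hK', map_sum]
  simp only [he, hB]

/-- The case in which the operator sees only the modes `B` and passes through the exponential. -/
theorem commutator_twist_of_modes {T : Module.End ℂ V} {t : ℤ}
    (he : ∀ p v, T (e p v) = e p (T v))
    (hB : ∀ n v, T (B n v) - B n (T v) = B (n + t) v) (n : ℤ) (v : V) :
    T (twist hfin n v) - twist hfin n (T v) = twist hfin (n + t) v := by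
  obtain ⟨K₁, h₁⟩ := hfin n v
  obtain ⟨K₂, h₂⟩ := hfin (n + t) v
  obtain ⟨K₃, h₃⟩ := hfin n (T v)
  set K := K₁ ⊔ K₂ ⊔ K₃
  rw [twist_apply hfin (K := K) fun p hp => h₁ p (by omega),
    twist_apply hfin (K := K) fun p hp => h₂ p (by omega),
    twist_apply hfin (K := K) fun p hp => h₃ p (by omega), map_sum, ← sum_sub_distrib]
  refine sum_congr rfl fun p _ => ?_
  rw [he, ← map_sub, hB, add_right_comm]

/-- The complementary case: the operator sees only the exponential and lowers its index by r.
Reindexing p ↦ p + r turns this into a shift of the mode by s r. -/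
theorem commutator_twist_of_exp {T : Module.End ℂ V} {r : ℕ}
    (he : ∀ p v, T (e p v) - e p (T v) = if r ≤ p then e (p - r) v else 0)
    (hB : ∀ n v, T (B n v) = B n (T v)) (n : ℤ) (v : V) :
    T (twist hfin n v) - twist hfin n (T v) = twist hfin (n + s * r) v := by
  obtain ⟨K₁, h₁⟩ := hfin n v
  obtain ⟨K₂, h₂⟩ := hfin (n + s * r) v
  obtain ⟨K₃, h₃⟩ := hfin n (T v)
  set K := K₁ ⊔ K₂ ⊔ K₃
  rw [twist_apply hfin (K := r + K) fun p hp => h₁ p (by omega),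
    twist_apply hfin (K := K) fun p hp => h₂ p (by omega),
    twist_apply hfin (K := r + K) fun p hp => h₃ p (by omega), map_sum, ← sum_sub_distrib]
  simp only [← hB, he]
  rw [sum_range_add, sum_eq_zero (fun p hp => if_neg (by simpa using hp)), zero_add]
  refine sum_congr rfl fun p _ => ?_
  rw [if_pos (by omega), add_tsub_cancel_left]
  congr 3
  push_cast
  ring

/-- The commutators of the twisted modes. -/
theorem commutator_twist (hs : s = 1 ∨ s = -1) {G : ℤ → Module.End ℂ V} {g : ℕ → Module.End ℂ V}
    {ξ : ℂ} (hee : ∀ p q v, e p (e q v) = e q (e p v)) (heB : ∀ p n v, e p (B n v) = B n (e p v))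
    (hBB : ∀ m n v, B m (B n v) - B n (B m v) =
      (2 * sgn m) • (G (m + n) v + (if m + n = 0 then m * ξ else 0) • v))
    (h1 : ∀ (N : ℕ) v, ∑ x ∈ antidiagonal N, (-1 : ℂ) ^ x.1 • e x.1 (e x.2 v) = if N = 0 then v else 0)
    (h2 : ∀ (N : ℕ) v, ∑ x ∈ antidiagonal N, ((-1 : ℂ) ^ x.1 * (x.1 : ℂ)) • e x.1 (e x.2 v) = g N v)
    (m n : ℤ) (v : V) :
    twist hfin m (twist hfin n v) - twist hfin n (twist hfin m v) =
      (2 * sgn m) • (G (m + n) v + (if m + n = 0 then m * ξ else 0) • v +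
        (if 0 ≤ -s * (m + n) then (s * ξ) • g (m + n).natAbs v else 0)) := by
  -- Only finitely many pairs (p, q) contribute: q is bounded first, then p for each of the finitely
  -- many remaining q.
  have bound : ∀ m n : ℤ, ∃ K, ∀ p q : ℕ, K ≤ p ∨ K ≤ q →
      e p (B (m + s * p) (e q (B (n + s * q) v))) = 0 := fun m n => by
    obtain ⟨Q, hQ⟩ := hfin n v
    choose P hP using fun q : ℕ => hfin m (e q (B (n + s * q) v))
    refine ⟨Q ⊔ (range Q).sup P, fun p q h => ?_⟩
    by_cases hq : Q ≤ q
    · rw [hQ q hq, map_zero, map_zero]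
    · refine hP q p (le_trans (Finset.le_sup (mem_range.2 (not_le.1 hq))) ?_)
      omega
  have expand : ∀ m n : ℤ, ∀ K, (∀ p q : ℕ, K ≤ p ∨ K ≤ q →
      e p (B (m + s * p) (e q (B (n + s * q) v))) = 0) → twist hfin m (twist hfin n v) =
        ∑ p ∈ range K, ∑ q ∈ range K, e p (B (m + s * p) (e q (B (n + s * q) v))) := by
    intro m n K hK
    obtain ⟨Q, hQ⟩ := hfin n v
    rw [twist_apply hfin (K := K ⊔ Q) fun q hq => hQ q (by omega),
      twist_apply hfin (K := K) fun p hp => by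
        rw [map_sum, map_sum]
        exact sum_eq_zero fun q _ => hK p q (Or.inl hp)]
    refine sum_congr rfl fun p _ => ?_
    rw [map_sum, map_sum]
    refine (sum_subset (range_mono le_sup_left) fun q _ hq => hK p q (Or.inr ?_)).symm
    simpa using hq
  obtain ⟨K₁, hK₁⟩ := bound m n
  obtain ⟨K₂, hK₂⟩ := bound n m
  set K := K₁ ⊔ K₂
  -- The commutator of the p-term with the q-term, exponentials moved to the left. The sign (-1)ᵖ
  -- comes from `sgn (m + s p)`, and the central term contributes the factor m + s p, linear in p.
  set f : ℕ × ℕ → V := fun x => (2 * sgn m) • ((-1 : ℂ) ^ x.1 • e x.1 (e x.2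
    (G (m + n + s * (x.1 + x.2 : ℕ)) v +
      (if m + n + s * (x.1 + x.2 : ℕ) = 0 then (m + s * x.1) * ξ else 0) • v))) with hf
  have hf' : ∀ p q : ℕ, f (p, q) = e p (B (m + s * p) (e q (B (n + s * q) v))) -
      e q (B (n + s * q) (e p (B (m + s * p) v))) := fun p q => by
    have h := hBB (m + s * p) (n + s * q) v
    have hi : m + s * p + (n + s * q) = m + n + s * (p + q : ℕ) := by push_cast; ring
    have hsg : sgn (m + s * p) = sgn m * (-1) ^ p := by
      rw [sgn_add]
      congr 1
      rcases hs with rfl | rfl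
      · simp [sgn]
      · rw [neg_one_mul, sgn, zpow_neg, zpow_natCast, ← inv_pow, inv_neg_one]
    rw [hi, hsg] at h
    rw [← heB q, ← heB p, hee q p, ← map_sub, ← map_sub, h]
    simp only [hf, map_smul, smul_smul, mul_assoc]
    push_cast
    rfl
  have hf0 : ∀ x : ℕ × ℕ, x ∉ range K ×ˢ range K → f x = 0 := fun x hx => by
    have hx' : K ≤ x.1 ∨ K ≤ x.2 := by
      rw [mem_product, mem_range, mem_range] at hx
      omega
    rw [hf' x.1 x.2, hK₁ _ _ (by omega), hK₂ _ _ (by omega), sub_zero]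
  -- Large enough for the antidiagonals below `L` to cover the square of contributing pairs and to
  -- include N = |m + n|, the only one that can carry a central term.
  set L := 2 * K + (m + n).natAbs + 1 with hL
  have hsum : twist hfin m (twist hfin n v) - twist hfin n (twist hfin m v) =
      ∑ N ∈ range L, ∑ x ∈ antidiagonal N, f x := by
    rw [expand m n K fun p q h => hK₁ p q (by omega), expand n m K fun p q h => hK₂ p q (by omega)]
    conv_lhs => enter [2]; rw [sum_comm]
    rw [← sum_sub_distrib]
    simp only [← sum_sub_distrib, ← hf']
    rw [← sum_product', ← sum_fiberwise_of_maps_to (g := fun x : ℕ × ℕ => x.1 + x.2)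
      (t := range L)]
    · refine sum_congr rfl fun N _ => sum_subset (fun x hx => ?_) fun x hx hx' => ?_
      · exact mem_antidiagonal.2 (mem_filter.1 hx).2
      · exact hf0 x fun h => hx' (mem_filter.2 ⟨h, mem_antidiagonal.1 hx⟩)
    · intro x hx
      rw [mem_product, mem_range, mem_range] at hx
      rw [mem_range]
      omega
  -- On an antidiagonal, the part independent of p survives only for N = 0 by `h1`; the part linear
  -- in p gives `g N` by `h2`.
  have hanti : ∀ N, ∑ x ∈ antidiagonal N, f x = (2 * sgn m) •
      ((if N = 0 then G (m + n) v + (if m + n = 0 then m * ξ else 0) • v else 0) +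
        if m + n + s * N = 0 then (s * ξ) • g N v else 0) := fun N => by
    have h : ∀ x ∈ antidiagonal N, f x = (2 * sgn m) • ((-1 : ℂ) ^ x.1 • e x.1 (e x.2
        (G (m + n + s * N) v + (if m + n + s * N = 0 then m * ξ else 0) • v)) +
        (if m + n + s * N = 0 then s * ξ else 0) • ((-1 : ℂ) ^ x.1 * (x.1 : ℂ)) • e x.1 (e x.2 v)) := by
      intro x hx
      simp only [hf, mem_antidiagonal.1 hx]
      congr 1
      split_ifs
      · simp only [map_add, map_smul]
        module
      · simp
    rw [sum_congr rfl h, ← smul_sum, sum_add_distrib, ← smul_sum, h1, h2]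
    congr 2
    · rcases eq_or_ne N 0 with rfl | hN
      · rw [if_pos rfl, if_pos rfl, Nat.cast_zero, mul_zero, add_zero]
      · rw [if_neg hN, if_neg hN]
    · split_ifs
      · rfl
      · rw [zero_smul]
  rw [hsum, sum_congr rfl fun N _ => hanti N, ← smul_sum, sum_add_distrib]
  congr 2
  · rw [sum_ite_eq' (range L) 0, if_pos (mem_range.2 (by omega))]
  · split_ifs with h
    · rw [sum_eq_single (m + n).natAbs]
      · rw [if_pos]
        rcases hs with rfl | rfl <;> omega
      · intro N _ hN
        rw [if_neg]
        rcases hs with rfl | rfl <;> omega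
      · intro hN
        exact absurd (mem_range.2 (by omega)) hN
    · refine sum_eq_zero fun N _ => if_neg ?_
      rcases hs with rfl | rfl <;> omega

end Twist

/-! ### The Fock space realization -/

theorem end_commute_iff {V : Type*} [AddCommGroup V] [Module ℂ V] {x y : Module.End ℂ V} :
    Commute x y ↔ ∀ v, x (y v) = y (x v) :=
  LinearMap.ext_iff

theorem end_neg_one_pow_apply {V : Type*} [AddCommGroup V] [Module ℂ V] (p : ℕ) (v : V) :
    ((-1 : Module.End ℂ V) ^ p) v = (-1 : ℂ) ^ p • v := by
  rcases Nat.even_or_odd p with h | h <;> rw [h.neg_one_pow, h.neg_one_pow] <;> simp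

theorem end_natCast_apply {V : Type*} [AddCommGroup V] [Module ℂ V] (n : ℕ) (v : V) :
    (n : Module.End ℂ V) v = (n : ℂ) • v := by
  rw [Module.End.natCast_apply, Nat.cast_smul_eq_nsmul]

theorem expCoeff_apply_of_forall {V : Type*} [AddCommGroup V] [Module ℂ V]
    {c : ℕ → Module.End ℂ V} {v : V} (h : ∀ j, c j v = 0) (n : ℕ) :
    expCoeff c n v = if n = 0 then v else 0 := by
  induction n using Nat.strong_induction_on with
  | _ n ih =>
    cases n with
    | zero => simp [expCoeff]
    | succ n =>
      rw [if_neg n.succ_ne_zero, expCoeff, LinearMap.smul_apply, LinearMap.sum_apply,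
        Finset.sum_eq_zero, smul_zero]
      rintro i -
      rw [Module.End.mul_apply, ih i i.2]
      split_ifs <;> simp [h]

/-- The polynomial ring underlying the Fock space. The variables with first index `0` and `1` are the
negative modes of `c` and `d`, those with first index `2` the negative modes of a Heisenberg
algebra. -/
abbrev Fock : Type := MvPolynomial (Fin 3 × ℕ) ℂ

namespace Fock

open MvPolynomial

/-- Multiplication by a variable. -/
def mX (i : Fin 3 × ℕ) : Module.End ℂ Fock := LinearMap.mulLeft ℂ (X i)

/-- Differentiation with respect to a variable. -/
def pd (i : Fin 3 × ℕ) : Module.End ℂ Fock := (pderiv i).toLinearMap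

theorem mX_apply (i : Fin 3 × ℕ) (v : Fock) : mX i v = X i * v := rfl

theorem pd_apply (i : Fin 3 × ℕ) (v : Fock) : pd i v = pderiv i v := rfl

theorem commute_mX (i j : Fin 3 × ℕ) : Commute (mX i) (mX j) :=
  end_commute_iff.2 fun _ => mul_left_comm _ _ _

theorem pd_mX (i j : Fin 3 × ℕ) (v : Fock) :
    pd i (mX j v) - mX j (pd i v) = if i = j then v else 0 := by
  rw [mX_apply, mX_apply, pd_apply, pd_apply, Derivation.leibniz, smul_eq_mul, smul_eq_mul,
    add_sub_cancel_left]
  rcases eq_or_ne i j with rfl | h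
  · rw [if_pos rfl, pderiv_X_self, mul_one]
  · rw [if_neg h, pderiv_X_of_ne h.symm, mul_zero]

theorem commute_pd_mX {i j : Fin 3 × ℕ} (h : i ≠ j) : Commute (pd i) (mX j) :=
  end_commute_iff.2 fun v => sub_eq_zero.1 (by rw [pd_mX, if_neg h])

theorem commute_pd (i j : Fin 3 × ℕ) : Commute (pd i) (pd j) := by
  refine end_commute_iff.2 fun v => ?_
  have h : ⁅(pderiv i : Derivation ℂ Fock Fock), (pderiv j : Derivation ℂ Fock Fock)⁆ = 0 := by
    have h0 : ∀ a b c : Fin 3 × ℕ, (pderiv a : Derivation ℂ Fock Fock) ((pderiv b : Derivation ℂ Fock Fock) (X c)) = 0 := fun a b c => by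
      rcases eq_or_ne c b with rfl | h
      · rw [pderiv_X_self]
        exact Derivation.map_one_eq_zero _
      · rw [pderiv_X_of_ne h, map_zero]
    refine derivation_ext fun c => ?_
    rw [Derivation.commutator_apply, h0, h0, sub_zero, Derivation.zero_apply]
  have h' := DFunLike.congr_fun h v
  rw [Derivation.commutator_apply] at h'
  exact sub_eq_zero.1 h'

theorem pd_C (i : Fin 3 × ℕ) (a : ℂ) : pd i (C a) = 0 := pderiv_C

theorem exists_pd_eq_zero (a : Fin 3) (v : Fock) : ∃ K, ∀ n, K ≤ n → pd (a, n) v = 0 := by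
  refine ⟨v.vars.sup Prod.snd + 1, fun n hn => pderiv_eq_zero_of_notMem_vars fun h => ?_⟩
  have := Finset.le_sup (f := Prod.snd) h
  dsimp only at this
  omega

/-- The negative modes of `c`, as multiplication operators. -/
def cNeg (j : ℕ) : Module.End ℂ Fock := if Odd j then mX (0, j) else 0

/-- The positive modes of `c`, as differential operators. -/
def cPos (j : ℕ) : Module.End ℂ Fock := if Odd j then (-j : ℂ) • pd (1, j) else 0

variable (ξ l : ℂ)

/-- The modes of the Heisenberg algebra. -/
def alpha (n : ℤ) : Module.End ℂ Fock :=
  if n < 0 then mX (2, n.natAbs) else if n = 0 then l • 1 else (2 * n * sgn n * ξ) • pd (2, n.natAbs)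

/-- The modes of `c`. -/
def cMode (n : ℤ) : Module.End ℂ Fock := if 0 < n then -ξ • cPos n.natAbs else ξ • cNeg n.natAbs

/-- The modes of `d`. -/
def dMode (n : ℤ) : Module.End ℂ Fock :=
  if Odd n then if 0 < n then (n : ℂ) • pd (0, n.natAbs) else mX (1, n.natAbs) else 0

theorem commute_alpha {x : Module.End ℂ Fock} (h1 : ∀ j, Commute x (mX (2, j)))
    (h2 : ∀ j, Commute x (pd (2, j))) (n : ℤ) : Commute x (alpha ξ l n) := by
  unfold alpha
  split_ifs
  · exact h1 _
  · exact (Commute.one_right x).smul_right _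
  · exact (h2 _).smul_right _

theorem commute_cNeg {x : Module.End ℂ Fock} (h : ∀ j, Commute x (mX (0, j))) (n : ℕ) :
    Commute x (cNeg n) := by
  unfold cNeg
  split_ifs
  · exact h _
  · exact Commute.zero_right x

theorem commute_cPos {x : Module.End ℂ Fock} (h : ∀ j, Commute x (pd (1, j))) (n : ℕ) :
    Commute x (cPos n) := by
  unfold cPos
  split_ifs
  · exact (h _).smul_right _
  · exact Commute.zero_right x

theorem cNeg_even {j : ℕ} (h : Even j) : cNeg j = 0 := if_neg (Nat.not_odd_iff_even.2 h)
theorem cPos_even {j : ℕ} (h : Even j) : cPos j = 0 := if_neg (Nat.not_odd_iff_even.2 h)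

theorem commute_cNeg_cNeg (i j : ℕ) : Commute (cNeg i) (cNeg j) :=
  commute_cNeg (fun _ => (commute_cNeg (fun _ => commute_mX _ _) i).symm) j

theorem commute_cPos_cPos (i j : ℕ) : Commute (cPos i) (cPos j) :=
  commute_cPos (fun _ => (commute_cPos (fun _ => commute_pd _ _) i).symm) j

theorem commute_cPos_cNeg (i j : ℕ) : Commute (cPos i) (cNeg j) :=
  commute_cNeg (fun _ => (commute_cPos (fun _ => (commute_pd_mX (by simp)).symm) i).symm) j

theorem commute_cNeg_alpha (i : ℕ) (n : ℤ) : Commute (cNeg i) (alpha ξ l n) :=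
  commute_alpha ξ l (fun _ => (commute_cNeg (fun _ => commute_mX _ _) i).symm)
    (fun _ => (commute_cNeg (fun _ => commute_pd_mX (by simp)) i).symm) n

theorem commute_cPos_alpha (i : ℕ) (n : ℤ) : Commute (cPos i) (alpha ξ l n) :=
  commute_alpha ξ l (fun _ => (commute_cPos (fun _ => (commute_pd_mX (by simp)).symm) i).symm)
    (fun _ => (commute_cPos (fun _ => commute_pd _ _) i).symm) n

theorem commute_dMode_alpha (m n : ℤ) : Commute (dMode m) (alpha ξ l n) := by
  refine commute_alpha ξ l (fun j => ?_) (fun j => ?_) n <;> unfold dMode <;> split_ifs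
  · exact (commute_pd_mX (by simp)).smul_left _
  · exact commute_mX _ _
  · exact Commute.zero_left _
  · exact (commute_pd _ _).smul_left _
  · exact (commute_pd_mX (by simp)).symm
  · exact Commute.zero_left _

theorem commute_dMode (m n : ℤ) : Commute (dMode m) (dMode n) := by
  have h1 : ∀ j, Commute (dMode m) (pd (0, j)) := fun j => by
    unfold dMode; split_ifs
    · exact (commute_pd _ _).smul_left _
    · exact (commute_pd_mX (by simp)).symm
    · exact Commute.zero_left _
  have h2 : ∀ j, Commute (dMode m) (mX (1, j)) := fun j => by
    unfold dMode; split_ifs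
    · exact (commute_pd_mX (by simp)).smul_left _
    · exact commute_mX _ _
    · exact Commute.zero_left _
  rw [dMode.eq_def n]
  split_ifs
  · exact (h1 _).smul_right _
  · exact h2 _
  · exact Commute.zero_right _

theorem commute_dMode_cPos {m : ℤ} (hm : 0 < m) (n : ℕ) : Commute (dMode m) (cPos n) := by
  refine commute_cPos (fun j => ?_) n
  unfold dMode; split_ifs
  · exact (commute_pd _ _).smul_left _
  · exact Commute.zero_left _

theorem commute_dMode_cNeg {m : ℤ} (hm : m < 0) (n : ℕ) : Commute (dMode m) (cNeg n) := by
  refine commute_cNeg (fun j => ?_) n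
  unfold dMode; split_ifs
  · omega
  · exact commute_mX _ _
  · exact Commute.zero_left _

theorem dMode_cNeg {m : ℤ} (hm : 0 < m) (ho : Odd m) (j : ℕ) :
    dMode m * cNeg j - cNeg j * dMode m = if j = m.natAbs then (m.natAbs : Module.End ℂ Fock) else 0 := by
  refine LinearMap.ext fun v => ?_
  have hm' : (m.natAbs : ℂ) = m := by
    rw [← Int.cast_natCast, Int.natAbs_of_nonneg hm.le]
  rw [dMode, if_pos ho, if_pos hm]
  by_cases hj : Odd j
  · rw [cNeg, if_pos hj]
    have h : (m : ℂ) • pd (0, m.natAbs) (mX (0, j) v) - mX (0, j) ((m : ℂ) • pd (0, m.natAbs) v) =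
        (m : ℂ) • if (0, m.natAbs) = ((0, j) : Fin 3 × ℕ) then v else 0 := by
      rw [← pd_mX, map_smul, smul_sub]
    refine h.trans ?_
    rcases eq_or_ne j m.natAbs with rfl | h
    · rw [if_pos rfl, if_pos rfl, ← hm', end_natCast_apply]
    · rw [if_neg h, if_neg (by simpa using h.symm), smul_zero, LinearMap.zero_apply]
  · rw [cNeg, if_neg hj, mul_zero, zero_mul, sub_zero, if_neg]
    rintro rfl
    exact hj (Int.natAbs_odd.2 ho)

theorem dMode_cPos {m : ℤ} (hm : m < 0) (ho : Odd m) (j : ℕ) :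
    dMode m * cPos j - cPos j * dMode m = if j = m.natAbs then (m.natAbs : Module.End ℂ Fock) else 0 := by
  refine LinearMap.ext fun v => ?_
  rw [dMode, if_pos ho, if_neg hm.not_gt]
  by_cases hj : Odd j
  · rw [cPos, if_pos hj]
    have h : mX (1, m.natAbs) ((-j : ℂ) • pd (1, j) v) - (-j : ℂ) • pd (1, j) (mX (1, m.natAbs) v) =
        (j : ℂ) • if (1, j) = ((1, m.natAbs) : Fin 3 × ℕ) then v else 0 := by
      rw [← pd_mX, map_smul]
      module
    refine h.trans ?_
    rcases eq_or_ne j m.natAbs with rfl | h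
    · rw [if_pos rfl, if_pos rfl, end_natCast_apply]
    · rw [if_neg h, if_neg (by simpa using h), smul_zero, LinearMap.zero_apply]
  · rw [cPos, if_neg hj, mul_zero, zero_mul, sub_zero, if_neg]
    rintro rfl
    exact hj (Int.natAbs_odd.2 ho)

/-- The zero family is written out so that the relation has the shape required by
`commutator_twist`, with no C-term before twisting. -/
theorem alpha_alpha (m n : ℤ) (v : Fock) :
    alpha ξ l m (alpha ξ l n v) - alpha ξ l n (alpha ξ l m v) =
      (2 * sgn m) • ((0 : ℤ → Module.End ℂ Fock) (m + n) v +
        (if m + n = 0 then m * ξ else 0) • v) := by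
  have h0 : ∀ n v, alpha ξ l 0 (alpha ξ l n v) = alpha ξ l n (alpha ξ l 0 v) := fun n v => by
    simp [alpha]
  have hpn : ∀ m n : ℤ, 0 < m → n < 0 → ∀ v, alpha ξ l m (alpha ξ l n v) - alpha ξ l n (alpha ξ l m v) =
      (2 * sgn m) • (if m + n = 0 then m * ξ else 0) • v := fun m n hm hn v => by
    rw [alpha, if_neg hm.not_gt, if_neg hm.ne', alpha, if_pos hn, LinearMap.smul_apply,
      LinearMap.smul_apply, map_smul, ← smul_sub, pd_mX]
    by_cases h : m + n = 0
    · have h' : m.natAbs = n.natAbs := by omega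
      rw [if_pos (by rw [h']), if_pos h, smul_smul]
      congr 1
      ring
    · rw [if_neg, if_neg h, zero_smul, smul_zero, smul_zero]
      simp only [Prod.mk.injEq, true_and]
      omega
  rw [Pi.zero_apply, LinearMap.zero_apply, zero_add]
  rcases lt_trichotomy m 0 with hm | rfl | hm <;> rcases lt_trichotomy n 0 with hn | rfl | hn
  · rw [if_neg (by omega), zero_smul, smul_zero, sub_eq_zero, alpha, if_pos hm, alpha, if_pos hn]
    exact end_commute_iff.1 (commute_mX _ _) v
  · rw [h0, if_neg (by omega), sub_self, zero_smul, smul_zero]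
  · rw [← neg_sub, hpn n m hn hm, add_comm n m, ← smul_neg, ← neg_smul]
    by_cases h : m + n = 0
    · obtain rfl : n = -m := by omega
      have : sgn (-m) = sgn m := by rw [sgn, zpow_neg, ← inv_zpow, inv_neg_one]; rfl
      rw [if_pos h, if_pos h, this]
      push_cast
      congr 2
      ring
    · simp only [if_neg h, neg_zero, zero_smul, smul_zero]
  · rw [h0, if_neg (by omega), sub_self, zero_smul, smul_zero]
  · rw [sub_self, if_pos (by omega), Int.cast_zero, zero_mul, zero_smul, smul_zero]
  · rw [h0, if_neg (by omega), sub_self, zero_smul, smul_zero]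
  · exact hpn m n hm hn v
  · rw [h0, if_neg (by omega), sub_self, zero_smul, smul_zero]
  · rw [if_neg (by omega), zero_smul, smul_zero, sub_eq_zero, alpha, if_neg hm.not_gt,
      if_neg hm.ne', alpha, if_neg hn.not_gt, if_neg hn.ne']
    exact end_commute_iff.1 (((commute_pd _ _).smul_left _).smul_right _) v

theorem exists_alpha_eq_zero (n : ℤ) (v : Fock) :
    ∃ K, ∀ p : ℕ, K ≤ p → expCoeff cNeg p (alpha ξ l (n + 1 * p) v) = 0 := by
  obtain ⟨K, hK⟩ := exists_pd_eq_zero 2 v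
  refine ⟨K + n.natAbs + 1, fun p hp => ?_⟩
  rw [alpha, if_neg (by omega), if_neg (by omega), LinearMap.smul_apply, hK _ (by omega), smul_zero,
    map_zero]

/-- The modes of the Heisenberg algebra, twisted by the negative modes of `c`. -/
def half : ℤ → Module.End ℂ Fock := twist (exists_alpha_eq_zero ξ l)

theorem commute_half {x : Module.End ℂ Fock} (h1 : ∀ j, Commute x (cNeg j))
    (h2 : ∀ j, Commute x (alpha ξ l j)) (n : ℤ) : Commute x (half ξ l n) :=
  end_commute_iff.2 <| commute_twist _
    (fun p => end_commute_iff.1 (commute_expCoeff h1 p)) (fun j => end_commute_iff.1 (h2 j)) n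

theorem commute_expCoeff_cPos_half (p : ℕ) (n : ℤ) :
    Commute (expCoeff cPos p) (half ξ l n) :=
  commute_half ξ l (fun j => (commute_expCoeff (fun i => (commute_cPos_cNeg i j).symm) p).symm)
    (fun j => (commute_expCoeff (fun i => (commute_cPos_alpha ξ l i j).symm) p).symm) n

/-- Induction on the polynomial. For r odd, multiplication by the variable (1, r) is D(-r), whose
commutator with the p-th coefficient is the (p - r)-th; so each such factor raises the bound by r.
All other variables commute with the exponential. -/
theorem exists_expCoeff_cPos_eq_zero (v : Fock) : ∃ K, ∀ p, K ≤ p → expCoeff cPos p v = 0 := by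
  induction v using MvPolynomial.induction_on with
  | C a =>
    refine ⟨1, fun p hp => ?_⟩
    rw [expCoeff_apply_of_forall (fun j => ?_), if_neg (by omega)]
    unfold cPos
    split_ifs <;> simp [pd_C]
  | add u v hu hv =>
    obtain ⟨K, hK⟩ := hu
    obtain ⟨L, hL⟩ := hv
    exact ⟨K + L, fun p hp => by rw [map_add, hK p (by omega), hL p (by omega), add_zero]⟩
  | mul_X v i hv =>
    obtain ⟨K, hK⟩ := hv
    rw [mul_comm, ← mX_apply]
    by_cases h : i.1 = 1 ∧ Odd i.2
    · obtain ⟨i, r⟩ := i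
      obtain ⟨rfl, hr⟩ := h
      have ho : Odd (-r : ℤ) := by rw [odd_neg]; exact_mod_cast hr
      have hr0 := hr.pos
      have hd : dMode (-r) = mX (1, r) := by
        rw [dMode, if_pos ho, if_neg (by omega), Int.natAbs_neg, Int.natAbs_natCast]
      refine ⟨K + r, fun p hp => ?_⟩
      have h := commutator_expCoeff (cPos_even Even.zero) (r := (-r : ℤ).natAbs) (by omega)
        (dMode_cPos (by omega) ho) p
      have h' := LinearMap.congr_fun h v
      rw [if_pos (by omega), LinearMap.sub_apply, Module.End.mul_apply, Module.End.mul_apply,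
        hK _ (by omega), hK _ (by omega), map_zero, zero_sub, neg_eq_zero, hd] at h'
      exact h'
    · refine ⟨K, fun p hp => ?_⟩
      have hc : Commute (mX i) (expCoeff cPos p) := by
        refine commute_expCoeff (fun j => ?_) p
        unfold cPos
        split_ifs with hj
        · refine ((commute_pd_mX ?_).smul_left _).symm
          rintro rfl
          exact h ⟨rfl, hj⟩
        · exact Commute.zero_right _
      rw [← end_commute_iff.1 hc, hK p hp, map_zero]

theorem exists_half_eq_zero (n : ℤ) (v : Fock) :
    ∃ K, ∀ p : ℕ, K ≤ p → expCoeff cPos p (half ξ l (n + -1 * p) v) = 0 := by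
  obtain ⟨K, hK⟩ := exists_expCoeff_cPos_eq_zero v
  exact ⟨K, fun p hp => by
    rw [end_commute_iff.1 (commute_expCoeff_cPos_half ξ l p _), hK p hp, map_zero]⟩

/-- The modes `(a + (-1)ⁿ b)(n)`. -/
def aMode : ℤ → Module.End ℂ Fock := twist (exists_half_eq_zero ξ l)

theorem commute_aMode {x : Module.End ℂ Fock} (h1 : ∀ j, Commute x (cPos j))
    (h2 : ∀ j, Commute x (half ξ l j)) (n : ℤ) : Commute x (aMode ξ l n) :=
  end_commute_iff.2 <| commute_twist _
    (fun p => end_commute_iff.1 (commute_expCoeff h1 p)) (fun j => end_commute_iff.1 (h2 j)) n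

theorem expCoeff_antidiagonal {c : ℕ → Module.End ℂ Fock} (hodd : ∀ j, Even j → c j = 0)
    (hcomm : ∀ i j, Commute (c i) (c j)) (N : ℕ) (v : Fock) :
    ∑ x ∈ Finset.HasAntidiagonal.antidiagonal N, (-1 : ℂ) ^ x.1 • expCoeff c x.1 (expCoeff c x.2 v) =
      (if N = 0 then v else 0) ∧
    ∑ x ∈ Finset.HasAntidiagonal.antidiagonal N, ((-1 : ℂ) ^ x.1 * (x.1 : ℂ)) • expCoeff c x.1 (expCoeff c x.2 v) =
      (-c N) v := by
  obtain ⟨h1, h2⟩ := expCoeff_neg (hodd 0 Even.zero) hodd hcomm N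
  constructor
  · have h := LinearMap.congr_fun h1 v
    rw [LinearMap.sum_apply] at h
    convert h using 1
    · refine Finset.sum_congr rfl fun x _ => ?_
      rw [Module.End.mul_apply, Module.End.mul_apply, end_neg_one_pow_apply]
    · split_ifs <;> rfl
  · rw [← h2, LinearMap.sum_apply]
    refine Finset.sum_congr rfl fun x _ => ?_
    rw [Module.End.mul_apply, Module.End.mul_apply, Module.End.mul_apply, end_neg_one_pow_apply,
      end_natCast_apply, smul_smul]

/-- The first twist, with s = 1, turns the Heisenberg relation into one that acquires the negative
modes of c. -/
theorem half_half (m n : ℤ) (v : Fock) :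
    half ξ l m (half ξ l n v) - half ξ l n (half ξ l m v) =
      (2 * sgn m) • ((if 0 ≤ -(m + n) then -ξ • cNeg (m + n).natAbs else 0 : Module.End ℂ Fock) v +
        (if m + n = 0 then m * ξ else 0) • v) := by
  have h := commutator_twist (exists_alpha_eq_zero ξ l) (Or.inl rfl) (G := 0)
    (fun p q => end_commute_iff.1 (commute_expCoeff
      (fun j => (commute_expCoeff (fun i => commute_cNeg_cNeg j i) p).symm) q))
    (fun p n => end_commute_iff.1 (commute_expCoeff
      (fun i => (commute_cNeg_alpha ξ l i n).symm) p).symm)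
    (alpha_alpha ξ l)
    (fun N v => (expCoeff_antidiagonal (fun _ => cNeg_even) commute_cNeg_cNeg N v).1)
    (g := fun N => -cNeg N)
    (fun N v => (expCoeff_antidiagonal (fun _ => cNeg_even) commute_cNeg_cNeg N v).2) m n v
  refine h.trans ?_
  rw [Pi.zero_apply, LinearMap.zero_apply, zero_add, add_comm, neg_one_mul]
  congr 2
  split_ifs <;> simp

/-- The second twist, with s = -1, takes the relation of `half` as input and adds the positive modes
of c. For m + n = 0 both corrections vanish, since 0 is even. -/
theorem aMode_aMode (m n : ℤ) (v : Fock) :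
    aMode ξ l m (aMode ξ l n v) - aMode ξ l n (aMode ξ l m v) =
      (2 * sgn m) • (-cMode ξ (m + n) v + (if m + n = 0 then m * ξ else 0) • v) := by
  have h := commutator_twist (exists_half_eq_zero ξ l) (Or.inr rfl)
    (G := fun N => if 0 ≤ -N then -ξ • cNeg N.natAbs else 0)
    (fun p q => end_commute_iff.1 (commute_expCoeff
      (fun j => (commute_expCoeff (fun i => commute_cPos_cPos j i) p).symm) q))
    (fun p n => end_commute_iff.1 (commute_expCoeff_cPos_half ξ l p n))
    (half_half ξ l)
    (fun N v => (expCoeff_antidiagonal (fun _ => cPos_even) commute_cPos_cPos N v).1)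
    (g := fun N => -cPos N)
    (fun N v => (expCoeff_antidiagonal (fun _ => cPos_even) commute_cPos_cPos N v).2) m n v
  refine h.trans ?_
  rw [add_right_comm, neg_neg, one_mul, cMode]
  congr 2
  rcases lt_trichotomy (m + n) 0 with h | h | h
  · rw [if_pos (by omega), if_neg (by omega), if_neg (by omega)]
    simp
  · rw [if_pos (by omega), if_pos (by omega), if_neg (by omega), h, Int.natAbs_zero,
      cNeg_even Even.zero, cPos_even Even.zero]
    simp
  · rw [if_neg (by omega), if_pos (by omega), if_pos (by omega)]
    simp

/-- A positive mode of d sees only the exponential in the negative modes of c, and a negative one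
only the exponential in the positive modes. In both cases it shifts the index of the exponential,
and hence that of A. -/
theorem dMode_aMode (m n : ℤ) (v : Fock) (ho : Odd m) :
    dMode m (aMode ξ l n v) - aMode ξ l n (dMode m v) = aMode ξ l (m + n) v := by
  have hpos : 0 < m.natAbs := Int.natAbs_pos.2 (by rintro rfl; simp at ho)
  rcases lt_or_gt_of_ne (Int.natAbs_pos.1 hpos) with hm | hm
  · have h := commutator_twist_of_exp (exists_half_eq_zero ξ l) (T := dMode m) (r := m.natAbs)
      (fun p v => by
        have := LinearMap.congr_fun
          (commutator_expCoeff (cPos_even Even.zero) hpos (dMode_cPos hm ho) p) v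
        refine this.trans ?_
        split_ifs <;> rfl)
      (fun n => end_commute_iff.1 (commute_half ξ l (commute_dMode_cNeg hm)
        (commute_dMode_alpha ξ l m) n)) n v
    refine h.trans ?_
    rw [show m + n = n + -1 * m.natAbs by omega]
    rfl
  · have h := commutator_twist_of_modes (exists_half_eq_zero ξ l) (T := dMode m) (t := m)
      (fun p => end_commute_iff.1 (commute_expCoeff (commute_dMode_cPos hm) p))
      (fun n v => by
        have h := commutator_twist_of_exp (exists_alpha_eq_zero ξ l) (T := dMode m) (r := m.natAbs)
          (fun p v => by
            have := LinearMap.congr_fun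
              (commutator_expCoeff (cNeg_even Even.zero) hpos (dMode_cNeg hm ho) p) v
            refine this.trans ?_
            split_ifs <;> rfl)
          (fun n => end_commute_iff.1 (commute_dMode_alpha ξ l m n)) n v
        refine h.trans ?_
        rw [show n + m = n + 1 * m.natAbs by omega]
        rfl) n v
    rw [add_comm m n]
    exact h

theorem commute_cMode {x : Module.End ℂ Fock} (h1 : ∀ j, Commute x (cPos j))
    (h2 : ∀ j, Commute x (cNeg j)) (n : ℤ) : Commute x (cMode ξ n) := by
  unfold cMode
  split_ifs
  · exact (h1 _).smul_right _
  · exact (h2 _).smul_right _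

theorem commute_cNeg_aMode (i : ℕ) (n : ℤ) : Commute (cNeg i) (aMode ξ l n) :=
  commute_aMode ξ l (fun j => (commute_cPos_cNeg j i).symm)
    (fun j => commute_half ξ l (commute_cNeg_cNeg i) (commute_cNeg_alpha ξ l i) j) n

theorem commute_cPos_aMode (i : ℕ) (n : ℤ) : Commute (cPos i) (aMode ξ l n) :=
  commute_aMode ξ l (commute_cPos_cPos i)
    (fun j => commute_half ξ l (commute_cPos_cNeg i) (commute_cPos_alpha ξ l i) j) n

theorem dMode_cMode (m n : ℤ) (v : Fock) (ho : Odd m) :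
    dMode m (cMode ξ n v) - cMode ξ n (dMode m v) = (if m + n = 0 then m * ξ else 0) • v := by
  have hm0 : m ≠ 0 := by rintro rfl; simp at ho
  have scal : ∀ (P : Prop) [Decidable P] (N : ℕ), (if P then (N : Module.End ℂ Fock) else 0) v =
      (if P then (N : ℂ) else 0) • v := fun P _ N => by
    split_ifs <;> simp [Nat.cast_smul_eq_nsmul]
  rcases lt_or_gt_of_ne hm0 with hm | hm <;> rcases lt_or_ge 0 n with hn | hn <;> unfold cMode
  · rw [if_pos hn]
    have h := LinearMap.congr_fun (dMode_cPos hm ho n.natAbs) v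
    rw [scal] at h
    rw [LinearMap.smul_apply, map_smul, LinearMap.smul_apply, ← smul_sub]
    refine (congrArg (-ξ • ·) h).trans ?_
    rw [smul_smul]
    congr 1
    by_cases h : m + n = 0
    · rw [if_pos h, if_pos (by omega), ← Int.cast_natCast, Int.ofNat_natAbs_of_nonpos hm.le]
      push_cast
      ring
    · rw [if_neg h, if_neg (by omega), mul_zero]
  · rw [if_neg hn.not_gt, if_neg (by omega), zero_smul, sub_eq_zero]
    exact end_commute_iff.1 ((commute_dMode_cNeg hm _).smul_right _) v
  · rw [if_pos hn, if_neg (by omega), zero_smul, sub_eq_zero]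
    exact end_commute_iff.1 ((commute_dMode_cPos hm _).smul_right _) v
  · rw [if_neg hn.not_gt]
    have h := LinearMap.congr_fun (dMode_cNeg hm ho n.natAbs) v
    rw [scal] at h
    rw [LinearMap.smul_apply, map_smul, LinearMap.smul_apply, ← smul_sub]
    refine (congrArg (ξ • ·) h).trans ?_
    rw [smul_smul]
    congr 1
    by_cases h : m + n = 0
    · rw [if_pos h, if_pos (by omega), ← Int.cast_natCast, Int.natAbs_of_nonneg hm.le]
      ring
    · rw [if_neg h, if_neg (by omega), mul_zero]

/-- The Fock space as a representation of level `ξ`. -/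
def modeRep : ModeRep Fock ξ where
  A := aMode ξ l
  C := cMode ξ
  D := dMode
  C_even n h := by
    have := Int.natAbs_even.2 h
    unfold cMode
    rw [cPos_even this, cNeg_even this]
    simp
  D_even n h := if_neg (Int.not_odd_iff_even.2 h)
  A_A m n v := by
    rw [aMode_aMode]
    split_ifs <;> module
  A_C m n := end_commute_iff.1 (commute_cMode ξ (fun j => (commute_cPos_aMode ξ l j m).symm)
    (fun j => (commute_cNeg_aMode ξ l j m).symm) n)
  C_C m n := end_commute_iff.1 (commute_cMode ξ
    (fun j => (commute_cMode ξ (commute_cPos_cPos j) (commute_cPos_cNeg j) m).symm)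
    (fun j => (commute_cMode ξ (fun i => (commute_cPos_cNeg i j).symm)
      (commute_cNeg_cNeg j) m).symm) n)
  D_D m n := end_commute_iff.1 (commute_dMode m n)
  D_A := dMode_aMode ξ l
  D_C := dMode_cMode ξ

theorem pd_one (i : Fin 3 × ℕ) : pd i 1 = 0 := by rw [← C_1, pd_C]

theorem cPos_one (j : ℕ) : cPos j 1 = 0 := by
  unfold cPos
  split_ifs
  · rw [LinearMap.smul_apply, pd_one, smul_zero]
  · rfl

/-- On the vacuum the positive modes of c vanish, so the outer exponential is the identity; for n ≥
0 every term of the inner sum with p ≥ 1 involves a positive mode of α, a derivative of 1. -/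
theorem aMode_one {n : ℤ} (hn : 0 ≤ n) : aMode ξ l n 1 = alpha ξ l n 1 := by
  have h1 : aMode ξ l n 1 = half ξ l n 1 := by
    refine (twist_apply (exists_half_eq_zero ξ l) (K := 1) fun p hp => ?_).trans ?_
    · rw [end_commute_iff.1 (commute_expCoeff_cPos_half ξ l p _),
        expCoeff_apply_of_forall cPos_one, if_neg (by omega), map_zero]
    · simp [expCoeff]
  rw [h1]
  refine (twist_apply (exists_alpha_eq_zero ξ l) (K := 1) fun p hp => ?_).trans ?_
  · rw [alpha, if_neg (by omega), if_neg (by omega), LinearMap.smul_apply, pd_one, smul_zero,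
      map_zero]
  · simp [expCoeff]

theorem aMode_zero_one : aMode ξ l 0 1 = l • 1 := by
  rw [aMode_one ξ l le_rfl]
  simp [alpha]

theorem isSingular_one : (modeRep ξ l).IsSingular 1 := fun n hn => by
  refine ⟨?_, ?_, ?_⟩
  · change aMode ξ l n 1 = 0
    rw [aMode_one ξ l hn.le, alpha, if_neg hn.not_gt, if_neg hn.ne', LinearMap.smul_apply, pd_one,
      smul_zero]
  · change cMode ξ n 1 = 0
    rw [cMode, if_pos hn, LinearMap.smul_apply, cPos_one, smul_zero]
  · change dMode n 1 = 0
    unfold dMode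
    split_ifs
    · rw [LinearMap.smul_apply, pd_one, smul_zero]
    · rfl

end Fock

open NappiWitten.Aff (tauHat el)

/-! ### The mode generators of the twisted algebra -/

theorem sgn_smul_mk (n : ℤ) : (-1 : ℂ) ^ n • H4.tau (H4.mk 1 (sgn n) 0 0) = H4.mk 1 (sgn n) 0 0 := by
  change sgn n • _ = _
  ext <;> simp [H4.tau_apply, sgn_mul_self]

/-- The characteristic function of the odd integers. -/
def par (n : ℤ) : ℂ := (1 - sgn n) / 2

theorem par_even {n : ℤ} (h : Even n) : par n = 0 := by rw [par, sgn_even h]; norm_num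
theorem par_odd {n : ℤ} (h : Odd n) : par n = 1 := by rw [par, sgn_odd h]; norm_num

theorem sgn_mul_par (n : ℤ) : sgn n * par n = -par n := by
  rcases Int.even_or_odd n with h | h
  · rw [par_even h]; simp
  · rw [sgn_odd h]; simp

/-- The element `(a + (-1)ⁿ b)(n)`. -/
def aEl (n : ℤ) : Tw := ⟨el (H4.mk 1 (sgn n) 0 0) n, el_mem_Tw (sgn_smul_mk n)⟩

/-- The element `c(n)` for odd `n`, and `0` for even `n`. -/
def cEl (n : ℤ) : Tw := ⟨el (H4.mk 0 0 (par n) 0) n, el_mem_Tw (by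
  change sgn n • _ = _
  ext <;> simp [H4.tau_apply, sgn_mul_par])⟩

/-- The element `d(n)` for odd `n`, and `0` for even `n`. -/
def dEl (n : ℤ) : Tw := ⟨el (H4.mk 0 0 0 (par n)) n, el_mem_Tw (by
  change sgn n • _ = _
  ext <;> simp [H4.tau_apply, sgn_mul_par])⟩

theorem el_congr_mem {x y : H4} {m n : ℤ} {hx : el x m ∈ Tw} {hy : el y n ∈ Tw} (h : x = y)
    (h' : m = n) : (⟨el x m, hx⟩ : Tw) = ⟨el y n, hy⟩ := by
  subst h h'; rfl

theorem apb_eq (j : ℤ) : apb j = aEl (2 * j) :=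
  el_congr_mem (by ext <;> simp [H4.a, H4.b, sgn_even (even_two_mul j)]) rfl

theorem amb_eq (j : ℤ) : amb j = aEl (2 * j + 1) :=
  el_congr_mem (by ext <;> simp [H4.a, H4.b, sgn_odd (odd_two_mul_add_one j)]) rfl

theorem c_eq (j : ℤ) : c j = cEl (2 * j + 1) :=
  el_congr_mem (by ext <;> simp [H4.c, par_odd (odd_two_mul_add_one j)]) rfl

theorem d_eq (j : ℤ) : d j = dEl (2 * j + 1) :=
  el_congr_mem (by ext <;> simp [H4.d, par_odd (odd_two_mul_add_one j)]) rfl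

theorem el_zero_mem {x : H4} {n : ℤ} {hx : el x n ∈ Tw} (h : x = 0) : (⟨el x n, hx⟩ : Tw) = 0 := by
  subst h
  apply Subtype.ext
  change el 0 n = 0
  ext1 <;> simp [el]

theorem cEl_even {n : ℤ} (h : Even n) : cEl n = 0 :=
  el_zero_mem (by ext <;> simp [par_even h])

theorem dEl_even {n : ℤ} (h : Even n) : dEl n = 0 :=
  el_zero_mem (by ext <;> simp [par_even h])

theorem el_lie {x y z : H4} {m n : ℤ} (t s : ℂ) {hx : el x m ∈ Tw} {hy : el y n ∈ Tw}
    (hz : el z (m + n) ∈ Tw) (hb : ⁅x, y⁆ = t • z)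
    (hf : (if m + n = 0 then (m : ℂ) * H4.form x y else 0) = s) :
    ⁅(⟨el x m, hx⟩ : Tw), (⟨el y n, hy⟩ : Tw)⁆ = t • (⟨el z (m + n), hz⟩ : Tw) + s • k := by
  apply Subtype.ext
  change ⁅el x m, el y n⁆ = t • el z (m + n) + s • Aff.k
  rw [Aff.el_lie_el, hb, hf]
  congr 1
  ext1 <;> simp [el]

theorem aEl_lie_aEl (m n : ℤ) : ⁅aEl m, aEl n⁆ =
    (-2 * sgn m) • cEl (m + n) + (if m + n = 0 then 2 * m * sgn m else 0 : ℂ) • k := by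
  refine el_lie _ _ _ ?_ ?_
  · have h : sgn n - sgn m = -2 * sgn m * par (m + n) := by
      have := sgn_mul_self m
      rw [par, sgn_add]
      linear_combination -sgn n * this
    ext <;> simp [H4.bracket_def, h]
  · split_ifs with h
    · obtain rfl : n = -m := by omega
      have : sgn (-m) = sgn m := by
        rw [← mul_right_inj' (sgn_ne_zero m), ← sgn_add, sgn_mul_self, add_neg_cancel]
        simp [sgn]
      simp [H4.form_apply, this]
      ring
    · rfl

theorem dEl_lie_aEl (m n : ℤ) : ⁅dEl m, aEl n⁆ = par m • aEl (m + n) := by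
  have := el_lie (x := H4.mk 0 0 0 (par m)) (y := H4.mk 1 (sgn n) 0 0) (m := m) (n := n)
    (par m) 0 (hx := (dEl m).2) (hy := (aEl n).2) (aEl (m + n)).2 (by
      ext <;> simp [H4.bracket_def]
      rw [sgn_add]
      linear_combination -sgn n * sgn_mul_par m) (by simp [H4.form_apply])
  rwa [zero_smul, add_zero] at this

theorem aEl_lie_cEl (m n : ℤ) : ⁅aEl m, cEl n⁆ = 0 := by
  -- The coefficient being 0, the target vector is immaterial; `aEl (m + n)` merely provides a
  -- member of `Tw`.
  have := el_lie (x := H4.mk 1 (sgn m) 0 0) (y := H4.mk 0 0 (par n) 0) (m := m) (n := n)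
    0 0 (hx := (aEl m).2) (hy := (cEl n).2) (aEl (m + n)).2
    (by ext <;> simp [H4.bracket_def]) (by simp [H4.form_apply])
  rwa [zero_smul, zero_smul, add_zero] at this

theorem cEl_lie_cEl (m n : ℤ) : ⁅cEl m, cEl n⁆ = 0 := by
  have := el_lie (x := H4.mk 0 0 (par m) 0) (y := H4.mk 0 0 (par n) 0) (m := m) (n := n)
    0 0 (hx := (cEl m).2) (hy := (cEl n).2) (aEl (m + n)).2
    (by ext <;> simp [H4.bracket_def]) (by simp [H4.form_apply])
  rwa [zero_smul, zero_smul, add_zero] at this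

theorem dEl_lie_dEl (m n : ℤ) : ⁅dEl m, dEl n⁆ = 0 := by
  have := el_lie (x := H4.mk 0 0 0 (par m)) (y := H4.mk 0 0 0 (par n)) (m := m) (n := n)
    0 0 (hx := (dEl m).2) (hy := (dEl n).2) (aEl (m + n)).2
    (by ext <;> simp [H4.bracket_def]) (by simp [H4.form_apply])
  rwa [zero_smul, zero_smul, add_zero] at this

theorem dEl_lie_cEl (m n : ℤ) : ⁅dEl m, cEl n⁆ = (if m + n = 0 then m * par m else 0 : ℂ) • k := by
  have := el_lie (x := H4.mk 0 0 0 (par m)) (y := H4.mk 0 0 (par n) 0) (m := m) (n := n)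
    0 (if m + n = 0 then m * par m else 0) (hx := (dEl m).2) (hy := (cEl n).2) (aEl (m + n)).2
    (by ext <;> simp [H4.bracket_def]) (by
      split_ifs with h
      · have h1 : par n = par m := by
          obtain rfl : n = -m := by omega
          rw [par, par, sgn, zpow_neg, ← inv_zpow, inv_neg_one]; rfl
        rcases Int.even_or_odd m with h | h
        · simp [H4.form_apply, par_even h]
        · simp [H4.form_apply, h1, par_odd h]
      · rfl)
  rwa [zero_smul, zero_add] at this

theorem k_lie' (x : Tw) : ⁅k, x⁆ = 0 := Subtype.ext (Aff.k_lie x)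

/-- The generators of the twisted algebra. -/
def modeGen : Set Tw := {x | x = k ∨ ∃ n, x = aEl n ∨ x = cEl n ∨ x = dEl n}

theorem tauLoop_apply (f : Loop) (n : ℤ) : Aff.tauLoop f n = (-1 : ℂ) ^ n • H4.tau (f n) := by
  induction f using Finsupp.induction_linear with
  | zero => simp
  | add f g hf hg => rw [map_add, Finsupp.add_apply, hf, hg, Finsupp.add_apply, map_add, smul_add]
  | single m x =>
    rw [Aff.tauLoop_single, Finsupp.smul_apply]
    rcases eq_or_ne m n with rfl | h
    · simp
    · rw [Finsupp.single_eq_of_ne' h, Finsupp.single_eq_of_ne' h]; simp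

/-- Being fixed by the automorphism forces, in degree n, the b-coordinate to be (-1)ⁿ times the
a-coordinate, and the c- and d-coordinates to vanish for n even. The factors `par n` therefore
change nothing. -/
theorem span_modeGen : Submodule.span ℂ modeGen = ⊤ := by
  refine eq_top_iff.2 fun u _ => ?_
  set f : Loop := Aff.loop u with hf
  have hu : ∀ n, sgn n • H4.tau (f n) = f n := fun n => by
    have h : Aff.loop (tauHat (u : Aff)) = Aff.loop u := congrArg Aff.loop u.2
    rw [Aff.tauHat_apply, Aff.loop_mk] at h
    have h' := DFunLike.congr_fun h n
    rw [tauLoop_apply] at h'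
    exact h'
  have hsum : u = ∑ n ∈ f.support, (f n 0 • aEl n + f n 2 • cEl n + f n 3 • dEl n) +
      Aff.central (u : Aff) • k := by
    apply Subtype.ext
    rw [AddMemClass.coe_add, AddSubmonoidClass.coe_finsetSum]
    ext1
    · have h : ∀ n, f n 0 • Finsupp.single n (H4.mk 1 (sgn n) 0 0) +
          f n 2 • Finsupp.single n (H4.mk 0 0 (par n) 0) +
          f n 3 • Finsupp.single n (H4.mk 0 0 0 (par n)) = Finsupp.single n (f n) := fun n => by
        rw [Finsupp.smul_single, Finsupp.smul_single, Finsupp.smul_single, ← Finsupp.single_add,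
          ← Finsupp.single_add]
        congr 1
        have h1 := congrArg (fun x : H4 => x 1) (hu n)
        have h2 := congrArg (fun x : H4 => x 2) (hu n)
        have h3 := congrArg (fun x : H4 => x 3) (hu n)
        simp only [H4.smul_apply, H4.tau_apply, H4.mk_one, H4.mk_two, H4.mk_three] at h1 h2 h3
        ext
        · simp
        · simp [← h1, mul_comm]
        · simp only [H4.add_apply, H4.smul_apply, H4.mk_two, par]; linear_combination h2 / 2
        · simp only [H4.add_apply, H4.smul_apply, H4.mk_three, par]; linear_combination h3 / 2
      rw [map_add, map_sum]
      change f = ∑ n ∈ f.support, (f n 0 • Finsupp.single n (H4.mk 1 (sgn n) 0 0) +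
          f n 2 • Finsupp.single n (H4.mk 0 0 (par n) 0) +
          f n 3 • Finsupp.single n (H4.mk 0 0 0 (par n))) + Aff.central (u : Aff) • (0 : Loop)
      rw [smul_zero, add_zero, Finset.sum_congr rfl fun n _ => h n]
      exact f.sum_single.symm
    · rw [map_add, map_sum, Finset.sum_eq_zero, zero_add]
      · exact (mul_one _).symm
      · intro n _
        change f n 0 • (0 : ℂ) + f n 2 • (0 : ℂ) + f n 3 • (0 : ℂ) = 0
        simp
  rw [hsum]
  have hmem : ∀ n, aEl n ∈ modeGen ∧ cEl n ∈ modeGen ∧ dEl n ∈ modeGen := fun n =>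
    ⟨Or.inr ⟨n, Or.inl rfl⟩, Or.inr ⟨n, Or.inr (Or.inl rfl)⟩, Or.inr ⟨n, Or.inr (Or.inr rfl)⟩⟩
  refine add_mem (sum_mem fun n _ => add_mem (add_mem ?_ ?_) ?_) ?_ <;>
    refine Submodule.smul_mem _ _ (Submodule.subset_span ?_)
  exacts [(hmem n).1, (hmem n).2.1, (hmem n).2.2, Or.inl rfl]

/-! ### Modules over the twisted algebra and mode operators -/

namespace ModeRep

variable {V : Type*} [AddCommGroup V] [Module ℂ V] {ξ : ℂ} (ρ : ModeRep V ξ)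

/-- A coordinate of `H4`, as a linear form. -/
def coord (i : Fin 4) : H4 →ₗ[ℂ] ℂ where
  toFun x := x i
  map_add' _ _ := rfl
  map_smul' _ _ := rfl

/-- The linear extension of the modes to the untwisted affine algebra. -/
def affMap : Aff →ₗ[ℂ] Module.End ℂ V :=
  -- The b-coordinate is omitted: on `Tw` the a-coordinate determines it. Only the restriction to
  -- `Tw` serves as a Lie algebra homomorphism.
  (Finsupp.lsum ℂ fun n => (coord 0).smulRight (ρ.A n) + (coord 2).smulRight (ρ.C n) +
    (coord 3).smulRight (ρ.D n)) ∘ₗ Aff.loop + Aff.central.smulRight (ξ • 1)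

theorem affMap_el (x : H4) (n : ℤ) :
    ρ.affMap (el x n) = x 0 • ρ.A n + x 2 • ρ.C n + x 3 • ρ.D n := by
  simp [affMap, el]
  rfl

/-- The linear map from the twisted algebra given by the modes. -/
def twMap : Tw →ₗ[ℂ] Module.End ℂ V := ρ.affMap ∘ₗ Tw.toSubmodule.subtype

theorem twMap_aEl (n : ℤ) : ρ.twMap (aEl n) = ρ.A n := by
  refine (ρ.affMap_el _ _).trans ?_
  simp

theorem twMap_cEl (n : ℤ) : ρ.twMap (cEl n) = ρ.C n := by
  refine (ρ.affMap_el _ _).trans ?_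
  rcases Int.even_or_odd n with h | h
  · simp [ρ.C_even n h]
  · simp [par_odd h]

theorem twMap_dEl (n : ℤ) : ρ.twMap (dEl n) = ρ.D n := by
  refine (ρ.affMap_el _ _).trans ?_
  rcases Int.even_or_odd n with h | h
  · simp [ρ.D_even n h]
  · simp [par_odd h]

theorem twMap_k : ρ.twMap k = ξ • 1 := by
  change ρ.affMap Aff.k = _
  simp [affMap, Aff.k]

theorem twMap_lie_of_mem {x y : Tw} (hx : x ∈ modeGen) (hy : y ∈ modeGen) :
    ρ.twMap ⁅x, y⁆ = ⁅ρ.twMap x, ρ.twMap y⁆ := by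
  have symm : ∀ {x y : Tw}, ρ.twMap ⁅x, y⁆ = ⁅ρ.twMap x, ρ.twMap y⁆ →
      ρ.twMap ⁅y, x⁆ = ⁅ρ.twMap y, ρ.twMap x⁆ := fun {x y} h => by
    rw [← lie_skew, map_neg, h, lie_skew]
  have hk : ∀ y, ρ.twMap ⁅k, y⁆ = ⁅ρ.twMap k, ρ.twMap y⁆ := fun y => by
    rw [k_lie', map_zero, twMap_k, LieRing.of_associative_ring_bracket, smul_one_mul, mul_smul_one,
      sub_self]
  have hac : ∀ m n, ρ.twMap ⁅aEl m, cEl n⁆ = ⁅ρ.twMap (aEl m), ρ.twMap (cEl n)⁆ := fun m n => by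
    rw [aEl_lie_cEl, map_zero, twMap_aEl, twMap_cEl, LieRing.of_associative_ring_bracket]
    exact (sub_eq_zero.2 (end_commute_iff.2 (ρ.A_C m n))).symm
  have hda : ∀ m n, ρ.twMap ⁅dEl m, aEl n⁆ = ⁅ρ.twMap (dEl m), ρ.twMap (aEl n)⁆ := fun m n => by
    rw [dEl_lie_aEl, map_smul, twMap_dEl, twMap_aEl, twMap_aEl, LieRing.of_associative_ring_bracket]
    rcases Int.even_or_odd m with h | h
    · rw [par_even h, ρ.D_even m h, zero_smul, zero_mul, mul_zero, sub_zero]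
    · rw [par_odd h, one_smul]
      exact LinearMap.ext fun v => (ρ.D_A m n v h).symm
  have hdc : ∀ m n, ρ.twMap ⁅dEl m, cEl n⁆ = ⁅ρ.twMap (dEl m), ρ.twMap (cEl n)⁆ := fun m n => by
    rw [dEl_lie_cEl, map_smul, twMap_k, twMap_dEl, twMap_cEl, LieRing.of_associative_ring_bracket]
    rcases Int.even_or_odd m with h | h
    · rw [par_even h, ρ.D_even m h, mul_zero, zero_mul, mul_zero, sub_zero]
      simp
    · rw [par_odd h]
      refine LinearMap.ext fun v => Eq.trans ?_ (ρ.D_C m n v h).symm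
      split_ifs <;> simp [smul_smul]
  rcases hx with rfl | ⟨m, rfl | rfl | rfl⟩
  · exact hk _
  all_goals rcases hy with rfl | ⟨n, rfl | rfl | rfl⟩
  · exact symm (hk _)
  · rw [aEl_lie_aEl, map_add, map_smul, map_smul, twMap_k, twMap_cEl, twMap_aEl, twMap_aEl,
      LieRing.of_associative_ring_bracket]
    refine LinearMap.ext fun v => Eq.trans ?_ (ρ.A_A m n v).symm
    split_ifs <;> simp [smul_smul]
  · exact hac m n
  · exact symm (hda n m)
  · exact symm (hk _)
  · exact symm (hac n m)
  · rw [cEl_lie_cEl, map_zero, twMap_cEl, twMap_cEl, LieRing.of_associative_ring_bracket]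
    exact (sub_eq_zero.2 (end_commute_iff.2 (ρ.C_C m n))).symm
  · exact symm (hdc n m)
  · exact symm (hk _)
  · exact hda m n
  · exact hdc m n
  · rw [dEl_lie_dEl, map_zero, twMap_dEl, twMap_dEl, LieRing.of_associative_ring_bracket]
    exact (sub_eq_zero.2 (end_commute_iff.2 (ρ.D_D m n))).symm

/-- The Lie algebra representation given by the modes. -/
def lieHom : Tw →ₗ⁅ℂ⁆ Module.End ℂ V :=
  { ρ.twMap with
    map_lie' := by
      intro x y
      change ρ.twMap ⁅x, y⁆ = ⁅ρ.twMap x, ρ.twMap y⁆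
      have hx : x ∈ Submodule.span ℂ modeGen := by rw [span_modeGen]; trivial
      have hy : y ∈ Submodule.span ℂ modeGen := by rw [span_modeGen]; trivial
      induction hx, hy using Submodule.span_induction₂ with
      | mem_mem x y hx hy => exact ρ.twMap_lie_of_mem hx hy
      | zero_left y hy => simp
      | zero_right x hx => simp
      | add_left x y z _ _ _ h h' => rw [add_lie, map_add, h, h', map_add, add_lie]
      | add_right x y z _ _ _ h h' => rw [lie_add, map_add, h, h', map_add, lie_add]
      | smul_left r x y _ _ h => rw [smul_lie, map_smul, h, map_smul, smul_lie]
      | smul_right r x y _ _ h => rw [lie_smul, map_smul, h, map_smul, lie_smul] }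

end ModeRep

/-! ### Generation of an enveloping algebra by its Lie algebra -/

section Generation

variable {L : Type*} [LieRing L] [LieAlgebra ℂ L]

/-- The canonical map factors through the subalgebra `S` and so extends to U → S. Followed by the
inclusion this is the identity, by uniqueness in the universal property, hence `S` is everything. -/
theorem adjoin_range_ι : Algebra.adjoin ℂ (Set.range (UniversalEnvelopingAlgebra.ι ℂ : L → _)) = ⊤ := by
  set S := Algebra.adjoin ℂ (Set.range (UniversalEnvelopingAlgebra.ι ℂ : L → _))
  have hmem : ∀ x : L, UniversalEnvelopingAlgebra.ι ℂ x ∈ S := fun x =>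
    Algebra.subset_adjoin ⟨x, rfl⟩
  let f : L →ₗ⁅ℂ⁆ S :=
    { toFun := fun x => ⟨UniversalEnvelopingAlgebra.ι ℂ x, hmem x⟩
      map_add' := fun x y => Subtype.ext (map_add _ _ _)
      map_smul' := fun t x => Subtype.ext (map_smul _ _ _)
      map_lie' := fun {x y} => Subtype.ext (by
        change UniversalEnvelopingAlgebra.ι ℂ ⁅x, y⁆ = _
        rw [LieHom.map_lie, LieRing.of_associative_ring_bracket]
        rfl) }
  have h : S.val.comp (UniversalEnvelopingAlgebra.lift ℂ f) = AlgHom.id ℂ _ := by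
    refine UniversalEnvelopingAlgebra.hom_ext (h := LieHom.ext fun x => ?_)
    change S.val (UniversalEnvelopingAlgebra.lift ℂ f (UniversalEnvelopingAlgebra.ι ℂ x)) = _
    rw [UniversalEnvelopingAlgebra.lift_ι_apply]
    rfl
  refine eq_top_iff.2 fun u _ => ?_
  rw [← AlgHom.id_apply (R := ℂ) u, ← h]
  exact (UniversalEnvelopingAlgebra.lift ℂ f u).2

theorem enveloping_induction {p : UniversalEnvelopingAlgebra ℂ L → Prop}
    (scalar : ∀ t, p (algebraMap ℂ _ t)) (gen : ∀ x, p (UniversalEnvelopingAlgebra.ι ℂ x))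
    (add : ∀ a b, p a → p b → p (a + b)) (mul : ∀ a b, p a → p b → p (a * b))
    (u : UniversalEnvelopingAlgebra ℂ L) : p u := by
  have hu : u ∈ Algebra.adjoin ℂ (Set.range (UniversalEnvelopingAlgebra.ι ℂ : L → _)) := by
    rw [adjoin_range_ι]; trivial
  induction hu using Algebra.adjoin_induction with
  | mem _ h => obtain ⟨x, rfl⟩ := h; exact gen x
  | algebraMap t => exact scalar t
  | add a b _ _ ha hb => exact add a b ha hb
  | mul a b _ _ ha hb => exact mul a b ha hb

end Generation

/-! ### Modules over the enveloping algebra as systems of modes -/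

section UMod

variable (Q : Type*) [AddCommGroup Q] [Module U Q] [Module ℂ Q] [IsScalarTower ℂ U Q]

/-- The action of an element of the twisted algebra on a `U`-module. -/
def act (x : Tw) : Module.End ℂ Q := Algebra.lsmul ℂ ℂ Q (toU x)

theorem act_apply (x : Tw) (v : Q) : act Q x v = toU x • v := rfl

theorem act_lie (x y : Tw) (v : Q) : act Q x (act Q y v) - act Q y (act Q x v) = act Q ⁅x, y⁆ v := by
  simp only [act_apply, LieHom.map_lie, LieRing.of_associative_ring_bracket, sub_smul, mul_smul]

theorem act_smul (t : ℂ) (x : Tw) (v : Q) : act Q (t • x) v = t • act Q x v := by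
  rw [act_apply, map_smul, smul_assoc]; rfl

theorem act_add (x y : Tw) (v : Q) : act Q (x + y) v = act Q x v + act Q y v := by
  rw [act_apply, map_add, add_smul]; rfl

theorem act_zero (v : Q) : act Q 0 v = 0 := by
  rw [act_apply, map_zero, zero_smul]

variable {Q}

/-- The modes of a `U`-module of level `ξ`. -/
def modes {ξ : ℂ} (hk : ∀ v : Q, toU k • v = ξ • v) : ModeRep Q ξ where
  A n := act Q (aEl n)
  C n := act Q (cEl n)
  D n := act Q (dEl n)
  C_even n h := by ext v; rw [cEl_even h, act_zero]; rfl
  D_even n h := by ext v; rw [dEl_even h, act_zero]; rfl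
  A_A m n v := by
    rw [act_lie, aEl_lie_aEl, act_add, act_smul, act_smul, act_apply Q k, hk, smul_smul, ite_mul,
      zero_mul]
  A_C m n v := by rw [← sub_eq_zero, act_lie, aEl_lie_cEl, act_zero]
  C_C m n v := by rw [← sub_eq_zero, act_lie, cEl_lie_cEl, act_zero]
  D_D m n v := by rw [← sub_eq_zero, act_lie, dEl_lie_dEl, act_zero]
  D_A m n v h := by rw [act_lie, dEl_lie_aEl, par_odd h, one_smul]
  D_C m n v h := by
    rw [act_lie, dEl_lie_cEl, par_odd h, act_smul, act_apply Q k, hk, smul_smul, ite_mul, zero_mul,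
      mul_one]

theorem smul_mem_of_act {N : Submodule ℂ Q} (h : ∀ x, ∀ v ∈ N, act Q x v ∈ N) (u : U) {v : Q}
    (hv : v ∈ N) : u • v ∈ N := by
  induction u using enveloping_induction generalizing v with
  | scalar t => rw [algebraMap_smul]; exact N.smul_mem t hv
  | gen x => exact h x v hv
  | add a b ha hb => rw [add_smul]; exact add_mem (ha hv) (hb hv)
  | mul a b ha hb => rw [mul_smul]; exact ha (hb hv)

theorem smul_mem_of_stable {ξ : ℂ} (hk : ∀ v : Q, toU k • v = ξ • v) {N : Submodule ℂ Q}
    (h : (modes hk).Stable N) (u : U) {v : Q} (hv : v ∈ N) : u • v ∈ N := by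
  refine smul_mem_of_act (fun x v hv => ?_) u hv
  have hx : x ∈ Submodule.span ℂ modeGen := by rw [span_modeGen]; trivial
  induction hx using Submodule.span_induction with
  | mem x hx =>
    obtain rfl | ⟨n, rfl | rfl | rfl⟩ := hx
    · rw [act_apply, hk]; exact N.smul_mem _ hv
    · exact (h n v hv).1
    · exact (h n v hv).2.1
    · exact (h n v hv).2.2
  | zero => rw [act_zero]; exact zero_mem _
  | add x y _ _ hx hy => rw [act_add]; exact add_mem hx hy
  | smul t x _ hx => rw [act_smul]; exact N.smul_mem _ hx

end UMod

/-! ### The universal Whittaker module of level `ξ` -/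

theorem aEl_mem_plusGen {n : ℤ} (hn : 0 < n) : aEl n ∈ plusGen := by
  obtain ⟨j, rfl | rfl⟩ := n.even_or_odd'
  · exact Or.inl ⟨j, by omega, (apb_eq j).symm⟩
  · exact Or.inr ⟨j, by omega, Or.inl (amb_eq j).symm⟩

theorem cEl_mem_plusGen {n : ℤ} (hn : 0 < n) (ho : Odd n) : cEl n ∈ plusGen := by
  obtain ⟨j, rfl⟩ := ho
  exact Or.inr ⟨j, by omega, Or.inr (Or.inl (c_eq j).symm)⟩

theorem dEl_mem_plusGen {n : ℤ} (hn : 0 < n) (ho : Odd n) : dEl n ∈ plusGen := by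
  obtain ⟨j, rfl⟩ := ho
  exact Or.inr ⟨j, by omega, Or.inr (Or.inr (d_eq j).symm)⟩

section

variable {Q : Type*} [AddCommGroup Q] [Module U Q]

theorem plus_smul_eq_zero {v : Q} (h : ∀ n, 0 < n → toU (aEl n) • v = 0 ∧ toU (cEl n) • v = 0 ∧
    toU (dEl n) • v = 0) (x : Plus) : toU x • v = 0 := by
  obtain ⟨x, hx⟩ := x
  change x ∈ Submodule.span ℂ plusGen at hx
  change toU x • v = 0
  induction hx using Submodule.span_induction with
  | mem x hx =>
    obtain ⟨j, hj, rfl⟩ | ⟨j, hj, rfl | rfl | rfl⟩ := hx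
    · rw [apb_eq]; exact (h _ (by omega)).1
    · rw [amb_eq]; exact (h _ (by omega)).1
    · rw [c_eq]; exact (h _ (by omega)).2.1
    · rw [d_eq]; exact (h _ (by omega)).2.2
  | zero => rw [map_zero, zero_smul]
  | add x y _ _ hx hy => rw [map_add, add_smul, hx, hy, add_zero]
  | smul t x _ hx => rw [map_smul, Algebra.smul_def, mul_smul, hx, smul_zero]

theorem inclU_smul_eq {v : Q} (h : ∀ x : Plus, toU x • v = 0) (p : UPlus) :
    inclU p • v = algebraMap ℂ U (charU 0 p) • v := by
  induction p using enveloping_induction with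
  | scalar t => rw [AlgHom.commutes, AlgHom.commutes]; rfl
  | gen x =>
    rw [inclU, charU, UniversalEnvelopingAlgebra.lift_ι_apply,
      UniversalEnvelopingAlgebra.lift_ι_apply]
    refine (h x).trans ?_
    rw [LieHom.zero_apply, map_zero, zero_smul]
  | add a b ha hb => rw [map_add, map_add, map_add, add_smul, add_smul, ha, hb]
  | mul a b ha hb =>
    rw [map_mul, map_mul, map_mul, mul_smul, hb, ← mul_smul, ← Algebra.commutes, mul_smul, ha,
      ← mul_smul, ← map_mul, mul_comm, map_mul]

/-- The homomorphism from `L_{0,ξ}` to a module of level `ξ` determined by a vector annihilated by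
the positive part. -/
def liftL (ξ : ℂ) (hk : ∀ w : Q, toU k • w = algebraMap ℂ U ξ • w) (v : Q)
    (h : ∀ x : Plus, toU x • v = 0) : WhittakerL 0 ξ →ₗ[U] Q :=
  (kSub 0 ξ).liftQ
    ((inducedRel 0).liftQ
      (LinearMap.toSpanSingleton U Q v ∘ₗ (TensorProduct.AlgebraTensorModule.rid ℂ U U).toLinearMap)
      (by
        refine Submodule.span_le.2 ?_
        rintro _ ⟨u, p, α, rfl⟩
        rw [SetLike.mem_coe, LinearMap.mem_ker, map_sub]
        simp only [LinearMap.comp_apply, LinearEquiv.coe_coe,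
          TensorProduct.AlgebraTensorModule.rid_tmul, LinearMap.toSpanSingleton_apply]
        rw [Algebra.smul_def, Algebra.smul_def, mul_smul, mul_smul u, inclU_smul_eq h, ← mul_smul,
          ← mul_smul, sub_eq_zero, mul_assoc, ← Algebra.commutes (charU 0 p) u, ← mul_assoc, ← map_mul,
          mul_comm α]))
    (by
      refine Submodule.span_le.2 ?_
      rintro _ ⟨m, rfl⟩
      rw [SetLike.mem_coe, LinearMap.mem_ker, map_smul, sub_smul, hk, sub_self])

theorem liftL_omegaBar (ξ : ℂ) (hk : ∀ w : Q, toU k • w = algebraMap ℂ U ξ • w) (v : Q)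
    (h : ∀ x : Plus, toU x • v = 0) : liftL ξ hk v h (omegaBar 0 ξ) = v := by
  change TensorProduct.AlgebraTensorModule.rid ℂ U U (1 ⊗ₜ 1) • v = v
  rw [TensorProduct.AlgebraTensorModule.rid_tmul, one_smul, one_smul]

end

variable (ξ l : ℂ)

theorem k_smul_L (w : WhittakerL 0 ξ) : toU k • w = algebraMap ℂ U ξ • w := by
  obtain ⟨m, rfl⟩ := (kSub 0 ξ).mkQ_surjective w
  rw [← sub_eq_zero, ← sub_smul, ← map_smul, Submodule.mkQ_apply, Submodule.Quotient.mk_eq_zero]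
  exact Submodule.subset_span ⟨m, rfl⟩

theorem k_smul_L' (w : WhittakerL 0 ξ) : toU k • w = ξ • w := by rw [k_smul_L, algebraMap_smul]

theorem plus_smul_omegaBar (x : Plus) : toU x • omegaBar 0 ξ = 0 := by
  have h : toU x • omega 0 = 0 := by
    rw [omega, ← map_smul, Submodule.mkQ_apply, Submodule.Quotient.mk_eq_zero]
    refine Submodule.subset_span ⟨1, UniversalEnvelopingAlgebra.ι ℂ x, 1, ?_⟩
    rw [inclU, charU, UniversalEnvelopingAlgebra.lift_ι_apply,
      UniversalEnvelopingAlgebra.lift_ι_apply, LieHom.zero_apply, zero_mul, TensorProduct.tmul_zero,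
      sub_zero, one_mul, TensorProduct.smul_tmul', smul_eq_mul, mul_one]
    rfl
  rw [omegaBar, ← map_smul, h, map_zero]

theorem exists_smul_omegaBar (w : WhittakerL 0 ξ) : ∃ u : U, u • omegaBar 0 ξ = w := by
  obtain ⟨m, rfl⟩ := (kSub 0 ξ).mkQ_surjective w
  obtain ⟨z, rfl⟩ := (inducedRel 0).mkQ_surjective m
  refine ⟨TensorProduct.AlgebraTensorModule.rid ℂ U U z, ?_⟩
  rw [omegaBar, omega, ← map_smul, ← map_smul, TensorProduct.smul_tmul', smul_eq_mul, mul_one]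
  congr 2
  exact (TensorProduct.AlgebraTensorModule.rid ℂ U U).symm_apply_apply z

theorem span_omegaBar : Submodule.span U {omegaBar 0 ξ} = ⊤ :=
  eq_top_iff.2 fun w _ => Submodule.mem_span_singleton.2 (exists_smul_omegaBar ξ w)

/-! ### Singular vectors and submodules in modules of level ξ -/

section

variable {Q : Type*} [AddCommGroup Q] [Module U Q] [Module ℂ Q] [IsScalarTower ℂ U Q] {ξ : ℂ}

theorem isSingular_iff (hk : ∀ w : Q, toU k • w = ξ • w) {v : Q} :
    (modes hk).IsSingular v ↔ ∀ x : Plus, toU x • v = 0 := by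
  refine ⟨plus_smul_eq_zero, fun h n hn => ⟨h ⟨_, Submodule.subset_span (aEl_mem_plusGen hn)⟩, ?_⟩⟩
  rcases Int.even_or_odd n with he | ho
  · rw [(modes hk).C_even n he, (modes hk).D_even n he]
    exact ⟨rfl, rfl⟩
  · exact ⟨h ⟨_, Submodule.subset_span (cEl_mem_plusGen hn ho)⟩,
      h ⟨_, Submodule.subset_span (dEl_mem_plusGen hn ho)⟩⟩

theorem aeval_modes (hk : ∀ w : Q, toU k • w = ξ • w) (f : Polynomial ℂ) (v : Q) :
    Polynomial.aeval ((modes hk).A 0) f v = Polynomial.aeval (toU (aEl 0)) f • v := by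
  have h : (modes hk).A 0 = Algebra.lsmul ℂ ℂ Q (toU (aEl 0)) := rfl
  rw [h, Polynomial.aeval_algHom_apply]
  rfl

/-- In a module of level `ξ ≠ 0` generated by a vector `v` annihilated by the positive part, every
nonzero submodule contains a nonzero vector `f((a+b)(0)) v`. -/
theorem exists_aeval_smul_mem (hξ : ξ ≠ 0) (hk : ∀ w : Q, toU k • w = ξ • w) {v : Q}
    (hv : ∀ x : Plus, toU x • v = 0) (hgen : Submodule.span U {v} = ⊤) {N : Submodule U Q}
    (hN : N ≠ ⊥) : ∃ f : Polynomial ℂ,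
      Polynomial.aeval (toU (aEl 0)) f • v ∈ N ∧ Polynomial.aeval (toU (aEl 0)) f • v ≠ 0 := by
  obtain ⟨f, hf⟩ := ModeRep.exists_aeval_mem ((isSingular_iff hk).2 hv) hξ (fun P hP hvP => by
      refine eq_top_iff.2 fun w _ => ?_
      have hw : w ∈ Submodule.span U {v} := by rw [hgen]; trivial
      obtain ⟨u, rfl⟩ := Submodule.mem_span_singleton.1 hw
      exact smul_mem_of_stable hk hP u hvP)
    (N := N.restrictScalars ℂ)
    (fun n w hw => ⟨N.smul_mem _ hw, N.smul_mem _ hw, N.smul_mem _ hw⟩)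
    (fun h => hN ((Submodule.restrictScalars_eq_bot_iff ℂ U Q).1 h))
  rw [aeval_modes] at hf
  exact ⟨f, hf⟩

end

/-! ### Comparison with the Fock spaces -/

/-- The Fock space with its structure of `U`-module of level `ξ`. -/
def FockMod (_ξ _l : ℂ) : Type := Fock

instance : AddCommGroup (FockMod ξ l) := inferInstanceAs (AddCommGroup Fock)

/-- The action of `U` on the Fock space. -/
def fockAct : U →ₐ[ℂ] Module.End ℂ Fock :=
  UniversalEnvelopingAlgebra.lift ℂ (Fock.modeRep ξ l).lieHom

instance : Module U (FockMod ξ l) := Module.compHom Fock (fockAct ξ l).toRingHom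

theorem fock_smul (u : U) (v : FockMod ξ l) : u • v = fockAct ξ l u v := rfl

theorem fockAct_toU (x : Tw) : fockAct ξ l (toU x) = (Fock.modeRep ξ l).twMap x :=
  UniversalEnvelopingAlgebra.lift_ι_apply ..

/-- The vacuum vector. -/
def vacuum : FockMod ξ l := (1 : Fock)

theorem vacuum_ne_zero : vacuum ξ l ≠ 0 := one_ne_zero (α := Fock)

theorem k_smul_fock (w : FockMod ξ l) : toU k • w = algebraMap ℂ U ξ • w := by
  refine (fock_smul ξ l _ w).trans (Eq.trans ?_ (fock_smul ξ l _ w).symm)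
  rw [fockAct_toU, ModeRep.twMap_k, AlgHom.commutes, Algebra.algebraMap_eq_smul_one]

theorem plus_smul_vacuum (x : Plus) : toU x • vacuum ξ l = 0 := by
  refine plus_smul_eq_zero (fun n hn => ?_) x
  obtain ⟨h1, h2, h3⟩ := Fock.isSingular_one ξ l n hn
  refine ⟨(fock_smul ξ l _ (vacuum ξ l)).trans ?_, (fock_smul ξ l _ (vacuum ξ l)).trans ?_, (fock_smul ξ l _ (vacuum ξ l)).trans ?_⟩
  · rw [fockAct_toU, ModeRep.twMap_aEl]; exact h1
  · rw [fockAct_toU, ModeRep.twMap_cEl]; exact h2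
  · rw [fockAct_toU, ModeRep.twMap_dEl]; exact h3

theorem aeval_smul_vacuum (f : Polynomial ℂ) :
    Polynomial.aeval (toU (aEl 0)) f • vacuum ξ l = algebraMap ℂ U (f.eval l) • vacuum ξ l := by
  refine (fock_smul ξ l _ (vacuum ξ l)).trans (Eq.trans ?_ (fock_smul ξ l _ (vacuum ξ l)).symm)
  rw [← Polynomial.aeval_algHom_apply, fockAct_toU, ModeRep.twMap_aEl, AlgHom.commutes]
  exact (Module.End.aeval_apply_of_hasEigenvector (Module.End.hasEigenvector_iff.2
    ⟨Module.End.mem_eigenspace_iff.2 (Fock.aMode_zero_one ξ l), one_ne_zero⟩)).trans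
    (Module.algebraMap_end_apply ..).symm

theorem algebraMap_smul_vacuum {t : ℂ} (ht : t ≠ 0) : algebraMap ℂ U t • vacuum ξ l ≠ 0 := by
  intro h
  apply vacuum_ne_zero ξ l
  rw [← one_smul U (vacuum ξ l), ← map_one (algebraMap ℂ U), ← inv_mul_cancel₀ ht, map_mul, mul_smul,
    h, smul_zero]

/-- The homomorphism from `L_{0,ξ}` to the Fock space that sends `ω̄` to the vacuum. -/
def toFock : WhittakerL 0 ξ →ₗ[U] FockMod ξ l :=
  liftL ξ (k_smul_fock ξ l) (vacuum ξ l) (plus_smul_vacuum ξ l)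

theorem toFock_omegaBar : toFock ξ l (omegaBar 0 ξ) = vacuum ξ l := liftL_omegaBar ..

/-- All Fock spaces are used at once: f(A(0)) ω̄ maps to f(l) times the vacuum of charge l, and l is
chosen off the roots of f. -/
theorem aeval_smul_omegaBar_ne_zero {f : Polynomial ℂ} (hf : f ≠ 0) :
    Polynomial.aeval (toU (aEl 0)) f • omegaBar 0 ξ ≠ 0 := by
  intro h
  obtain ⟨l, hl⟩ : ∃ l, f.eval l ≠ 0 := by
    by_contra! h
    exact hf (Polynomial.funext fun l => by rw [h, Polynomial.eval_zero])
  apply algebraMap_smul_vacuum ξ l hl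
  rw [← aeval_smul_vacuum, ← toFock_omegaBar, ← map_smul, h, map_zero]

/-! ### The shift endomorphism -/

theorem apb_zero : apb 0 = aEl 0 := apb_eq 0

theorem toU_sub_eq : toU (apb 0) - algebraMap ℂ U l =
    Polynomial.aeval (toU (aEl 0)) (Polynomial.X - Polynomial.C l) := by
  rw [map_sub, Polynomial.aeval_X, Polynomial.aeval_C, apb_zero]

/-- A(0) preserves singular vectors, so (A(0) - l) ω̄ is again a possible image of ω̄ under an
endomorphism of L. -/
theorem plus_smul_shift (x : Plus) :
    toU x • (toU (apb 0) - algebraMap ℂ U l) • omegaBar 0 ξ = 0 := by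
  refine (isSingular_iff (k_smul_L' ξ)).1 (ModeRep.isSingular_of_mem_zeroHull
    ((isSingular_iff (k_smul_L' ξ)).2 (plus_smul_omegaBar ξ)) ?_) x
  have h : omegaBar 0 ξ ∈ (modes (k_smul_L' ξ)).zeroHull (omegaBar 0 ξ) :=
    le_hull (Submodule.mem_span_singleton_self _)
  rw [sub_smul, algebraMap_smul, apb_zero]
  exact sub_mem (apply_mem_hull h) (Submodule.smul_mem _ _ h)

/-- The endomorphism of `L_{0,ξ}` that sends `ω̄` to `((a+b)(0) - l) ω̄`. -/
def shift : Module.End U (WhittakerL 0 ξ) :=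
  liftL ξ (k_smul_L ξ) _ (plus_smul_shift ξ l)

theorem shift_omegaBar :
    shift ξ l (omegaBar 0 ξ) = (toU (apb 0) - algebraMap ℂ U l) • omegaBar 0 ξ := liftL_omegaBar ..

theorem shift_pow_omegaBar (i : ℕ) : (shift ξ l ^ i) (omegaBar 0 ξ) = omegaPow ξ l i := by
  induction i with
  | zero => rw [pow_zero, omegaPow, pow_zero, one_smul]; rfl
  | succ i ih =>
    rw [pow_succ', Module.End.mul_apply, ih, omegaPow, map_smul, shift_omegaBar, ← mul_smul,
      ← pow_succ, omegaPow]

variable {ξ}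

/-- A nonzero kernel would contain some f(A(0)) ω̄ ≠ 0, whose image is f(A(0)) (A(0) - l) ω̄; this
is nonzero because f · (X - l) ≠ 0. -/
theorem shift_injective (hξ : ξ ≠ 0) : Function.Injective (shift ξ l) := by
  rw [← LinearMap.ker_eq_bot]
  by_contra h
  obtain ⟨f, hf, hf0⟩ := exists_aeval_smul_mem hξ (k_smul_L' ξ) (plus_smul_omegaBar ξ)
    (span_omegaBar ξ) h
  rw [LinearMap.mem_ker, map_smul, shift_omegaBar, toU_sub_eq, ← mul_smul, ← map_mul] at hf
  refine aeval_smul_omegaBar_ne_zero ξ (mul_ne_zero ?_ (Polynomial.X_sub_C_ne_zero l)) hf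
  rintro rfl
  simp at hf0

theorem shift_pow_injective (hξ : ξ ≠ 0) (i : ℕ) : Function.Injective (shift ξ l ^ i) := by
  rw [Module.End.coe_pow]
  exact (shift_injective l hξ).iterate i

variable (ξ)

theorem range_shift_pow (i : ℕ) : LinearMap.range (shift ξ l ^ i) = filt ξ l i := by
  rw [filt, LinearMap.range_eq_map, ← span_omegaBar, Submodule.map_span, Set.image_singleton,
    shift_pow_omegaBar]

variable {ξ}

/-- The isomorphism of `L_{0,ξ}` with `Mⁱ`. -/
def filtEquiv (hξ : ξ ≠ 0) (i : ℕ) : WhittakerL 0 ξ ≃ₗ[U] filt ξ l i :=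
  (LinearEquiv.ofInjective _ (shift_pow_injective l hξ i)).trans
    (LinearEquiv.ofEq _ _ (range_shift_pow ξ l i))

theorem filtEquiv_omegaBar (hξ : ξ ≠ 0) (i : ℕ) :
    filtEquiv l hξ i (omegaBar 0 ξ) = omegaFilt ξ l i :=
  Subtype.ext (shift_pow_omegaBar ξ l i)

variable (ξ)

theorem filt_zero : filt ξ l 0 = ⊤ := by
  rw [← range_shift_pow, pow_zero]
  exact LinearMap.range_id

theorem filt_antitone : Antitone (filt ξ l) := by
  refine antitone_nat_of_succ_le fun i => ?_
  rw [← range_shift_pow, ← range_shift_pow, pow_succ]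
  exact LinearMap.range_comp_le_range _ _

variable {ξ}

/-- The isomorphism L ≅ Mⁱ takes the generator (A(0) - l) ω̄ to the next power; both sides are
compared after embedding Mⁱ in L. -/
theorem map_vermaSub (hξ : ξ ≠ 0) (i : ℕ) : (vermaSub ξ l).map (filtEquiv l hξ i).toLinearMap =
    (filt ξ l (i + 1)).submoduleOf (filt ξ l i) := by
  apply Submodule.map_injective_of_injective (filt ξ l i).injective_subtype
  rw [Submodule.submoduleOf, Submodule.map_comap_subtype,
    inf_eq_right.2 (filt_antitone ξ l (Nat.le_succ i)), vermaSub, Submodule.map_span,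
    Submodule.map_span, Set.image_singleton, Set.image_singleton]
  change _ = Submodule.span U {omegaPow ξ l (i + 1)}
  congr 2
  rw [← shift_pow_omegaBar, pow_succ, Module.End.mul_apply, shift_omegaBar]
  rfl

/-- The isomorphism of `M(ξ, l)` with `Mⁱ / Mⁱ⁺¹`. -/
def sectionEquiv (hξ : ξ ≠ 0) (i : ℕ) : Verma ξ l ≃ₗ[U] FiltSection ξ l i :=
  Submodule.Quotient.equiv _ _ (filtEquiv l hξ i) (map_vermaSub l hξ i)

theorem sectionEquiv_vermaVec (hξ : ξ ≠ 0) (i : ℕ) :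
    sectionEquiv l hξ i (vermaVec ξ l) = omegaSection ξ l i := by
  rw [omegaSection, ← filtEquiv_omegaBar l hξ]
  rfl

theorem isCyclicWhittakerVector_omegaFilt (hξ : ξ ≠ 0) (i : ℕ) :
    IsCyclicWhittakerVector (filt ξ l i) 0 (omegaFilt ξ l i) := by
  rw [← filtEquiv_omegaBar l hξ]
  refine ⟨⟨?_, fun x => ?_⟩, ?_⟩
  · rw [Ne, LinearEquiv.map_eq_zero_iff]
    simpa using aeval_smul_omegaBar_ne_zero ξ (f := 1) one_ne_zero
  · rw [← map_smul, plus_smul_omegaBar, LieHom.zero_apply, map_zero, map_zero, zero_smul]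
  · rw [← LinearEquiv.coe_coe, ← Set.image_singleton, ← Submodule.map_span, span_omegaBar,
      Submodule.map_top, LinearEquiv.range]

/-! ### The Verma module -/

/-- The map from L to the Fock space of charge l kills (A(0) - l) ω̄ but not ω̄. -/
theorem vermaVec_ne_zero : vermaVec ξ l ≠ 0 := by
  rw [vermaVec, Submodule.mkQ_apply, Ne, Submodule.Quotient.mk_eq_zero]
  intro h
  have hle : vermaSub ξ l ≤ LinearMap.ker (toFock ξ l) := by
    refine (Submodule.span_singleton_le_iff_mem _ _).2 ?_
    rw [LinearMap.mem_ker, map_smul, toFock_omegaBar, toU_sub_eq, aeval_smul_vacuum]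
    simp
  have h' := hle h
  rw [LinearMap.mem_ker, toFock_omegaBar] at h'
  exact vacuum_ne_zero ξ l h'

theorem span_vermaVec : Submodule.span U {vermaVec ξ l} = ⊤ := by
  rw [vermaVec, ← Set.image_singleton, ← Submodule.map_span, span_omegaBar, Submodule.map_top,
    Submodule.range_mkQ]

/-- A nonzero submodule contains a nonzero f(A(0)) v with v the highest weight vector. As A(0) v = l
v, this is f(l) v with f(l) ≠ 0, so the submodule contains v and is everything. -/
theorem isSimpleModule_verma (hξ : ξ ≠ 0) : IsSimpleModule U (Verma ξ l) := by
  have hk : ∀ w : Verma ξ l, toU k • w = ξ • w := fun w => by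
    obtain ⟨w, rfl⟩ := (vermaSub ξ l).mkQ_surjective w
    rw [← map_smul, k_smul_L, map_smul, algebraMap_smul]
  have hv : ∀ x : Plus, toU x • vermaVec ξ l = 0 := fun x => by
    rw [vermaVec, ← map_smul, plus_smul_omegaBar, map_zero]
  have hA : toU (aEl 0) • vermaVec ξ l = l • vermaVec ξ l := by
    rw [← sub_eq_zero, ← algebraMap_smul U l, ← sub_smul, ← apb_zero, vermaVec, ← map_smul,
      Submodule.mkQ_apply, Submodule.Quotient.mk_eq_zero]
    exact Submodule.mem_span_singleton_self _
  have : Nontrivial (Verma ξ l) := ⟨_, _, vermaVec_ne_zero l⟩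
  rw [isSimpleModule_iff]
  refine { eq_bot_or_eq_top := fun N => or_iff_not_imp_left.2 fun hN => ?_ }
  obtain ⟨f, hf, hf0⟩ := exists_aeval_smul_mem hξ hk hv (span_vermaVec l) hN
  have h : Polynomial.aeval (toU (aEl 0)) f • vermaVec ξ l = f.eval l • vermaVec ξ l := by
    rw [← aeval_modes hk]
    exact Module.End.aeval_apply_of_hasEigenvector (Module.End.hasEigenvector_iff.2
      ⟨Module.End.mem_eigenspace_iff.2 hA, vermaVec_ne_zero l⟩)
  rw [h] at hf hf0
  rw [eq_top_iff, ← span_vermaVec, Submodule.span_singleton_le_iff_mem]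
  exact ((N.restrictScalars ℂ).smul_mem_iff fun h0 => hf0 (by rw [h0, zero_smul])).1 hf

theorem isSimpleModule_filtSection (hξ : ξ ≠ 0) (i : ℕ) : IsSimpleModule U (FiltSection ξ l i) :=
  have := isSimpleModule_verma l hξ
  IsSimpleModule.congr (sectionEquiv l hξ i).symm

/-! ### Multiplicity spaces as polynomials in one variable -/

section Multiplicity

variable {R : Type*} [Ring R] [Algebra ℂ R] {M : Type*} [AddCommGroup M] [Module R M] [Module ℂ M]
  [IsScalarTower ℂ R M] {N : ℕ → Type*} [∀ i, AddCommMonoid (N i)] [∀ i, Module R (N i)]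

/-- The isomorphism of `M ⊗ ℂ[X]` with a direct sum of copies of `M` indexed by `ℕ`. -/
def tensorPolynomialEquiv (e : ∀ i, M ≃ₗ[R] N i) :
    (M ⊗[ℂ] Polynomial ℂ) ≃ₗ[R] DirectSum ℕ N :=
  (TensorProduct.AlgebraTensorModule.congr (LinearEquiv.refl R M)
      (Polynomial.basisMonomials ℂ).repr).trans <|
    (TensorProduct.finsuppScalarRight ℂ R M ℕ).trans <|
      (finsuppLEquivDirectSum R M ℕ).trans <| DFinsupp.mapRange.linearEquiv e

theorem tensorPolynomialEquiv_tmul_X_pow (e : ∀ i, M ≃ₗ[R] N i) (v : M) (i : ℕ) :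
    tensorPolynomialEquiv e (v ⊗ₜ[ℂ] (Polynomial.X ^ i : Polynomial ℂ)) =
      DirectSum.lof R ℕ N i (e i v) := by
  have h : (Polynomial.basisMonomials ℂ).repr (Polynomial.X ^ i) = Finsupp.single i 1 := by
    rw [← (Polynomial.basisMonomials ℂ).repr_self, Polynomial.coe_basisMonomials,
      Polynomial.X_pow_eq_monomial]
  rw [tensorPolynomialEquiv, LinearEquiv.trans_apply, LinearEquiv.trans_apply,
    LinearEquiv.trans_apply, TensorProduct.AlgebraTensorModule.congr_tmul, h,
    TensorProduct.finsuppScalarRight_apply_tmul, Finsupp.sum_single_index (by simp), one_smul,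
    finsuppLEquivDirectSum_single]
  exact DFinsupp.mapRange_single (hf := fun i => map_zero (e i))

end Multiplicity

end NappiWitten
end

theorem theorem5p5 (ξ l : ℂ) (hξ : ξ ≠ 0) :
    -- `Mⁱ` is a Whittaker module with cyclic Whittaker vector `ωᵢ`; `Mⁱ⁺¹` is maximal in `Mⁱ`
    (∀ i : ℕ, IsCyclicWhittakerVector (filt ξ l i) 0 (omegaFilt ξ l i)) ∧
    (∀ i : ℕ, filt ξ l (i + 1) ⋖ filt ξ l i) ∧
    -- `L_{0,ξ} ≅ Mⁱ`
    (∀ i : ℕ, Nonempty (WhittakerL 0 ξ ≃ₗ[U] filt ξ l i)) ∧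
    -- `Mⁱ / Mⁱ⁺¹ ≅ M(ξ, l)`, and the multiplicity space of `⨁ᵢ Mⁱ / Mⁱ⁺¹` is `ℂ[X]`
    (∀ i : ℕ, Nonempty (FiltSection ξ l i ≃ₗ[U] Verma ξ l)) ∧
    (∃ Φ : (Verma ξ l ⊗[ℂ] Polynomial ℂ) ≃ₗ[U] DirectSum ℕ (FiltSection ξ l),
      ∀ i : ℕ, Φ (vermaVec ξ l ⊗ₜ[ℂ] (Polynomial.X ^ i : Polynomial ℂ)) =
        DirectSum.lof U ℕ (FiltSection ξ l) i (omegaSection ξ l i)) ∧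
    -- the filtration `L_{0,ξ} = M⁰ ⊇ M¹ ⊇ ⋯` has simple sections, and `M(ξ, l)` occurs among them
    -- with infinite multiplicity
    filt ξ l 0 = ⊤ ∧
    Antitone (filt ξ l) ∧
    (∀ i : ℕ, IsSimpleModule U (FiltSection ξ l i)) ∧
    IsSimpleModule U (Verma ξ l) ∧
    {i : ℕ | Nonempty (FiltSection ξ l i ≃ₗ[U] Verma ξ l)}.Infinite := by
  refine ⟨isCyclicWhittakerVector_omegaFilt l hξ, fun i => ?_, fun i => ⟨filtEquiv l hξ i⟩,
    fun i => ⟨(sectionEquiv l hξ i).symm⟩, ⟨tensorPolynomialEquiv (sectionEquiv l hξ),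
      fun i => by rw [tensorPolynomialEquiv_tmul_X_pow, sectionEquiv_vermaVec]⟩,
    filt_zero ξ l, filt_antitone ξ l, isSimpleModule_filtSection l hξ, isSimpleModule_verma l hξ,
    ?_⟩
  -- Maximality of Mⁱ⁺¹ in Mⁱ is equivalent to simplicity of the section.
  · rw [covBy_iff_quot_is_simple (filt_antitone ξ l (Nat.le_succ i))]
    exact isSimpleModule_filtSection l hξ i
  · exact Set.infinite_univ.mono fun i _ => ⟨(sectionEquiv l hξ i).symm⟩
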